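/- Let $(X,d)$ be a metric space and $f\colon X\to[-\infty,+\infty]$ lower semicontinuous; write $\mathcal D[f]=\{f\neq\pm\infty\}$ and $\mathcal D^\star[f]=\{f<+\infty\}$. Let $K\in\mathbb R$, $N<0$, put $f_N=e^{-f/N}$ (so that $f_N=0$ where $f=-\infty$), and let $$\mathfrak s_{K,N}(\theta)=\begin{cases}\sin(\theta\sqrt{K/N})/\sqrt{K/N}&K<0,\\ \theta&K=0,\\ \sinh(\theta\sqrt{-K/N})/\sqrt{-K/N}&K>0.\end{cases}$$ Let $T\in(0,+\infty]$ and let $(y_t)_{t\in(0,T)}\subset\mathcal D[f]$ be an $\mathrm{EVI}_{K,N}$ gradient curve for $f$, i.e. a continuous curve such that $$\frac{d^+}{dt}\Big[\mathfrak s_{K,N}\Big(\frac{d(y_t,z)}2\Big)^2\Big]+K\,\mathfrak s_{K,N}\Big(\frac{d(y_t,z)}2\Big)^2\le\frac N2\Big(1-\frac{f_N(z)}{f_N(y_t)}\Big)$$ for every $t\in(0,T)$ and every $z\in\mathcal D^\star[f]$, with $d(y_t,z)<\pi\sqrt{N/K}$ if $K<0$, where $\frac{d^+}{dt}g(t)=\limsup_{h\downarrow0}\frac{g(t+h)-g(t)}h$.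 Let $|\dot y_t|=\lim_{s\to t}\frac{d(y_s,y_t)}{|s-t|}$ be the metric derivative and $|D^-f|(x)=\limsup_{z\to x}\frac{(f(z)-f(x))^-}{d(z,x)}$, $x\in\mathcal D[f]$, the descending slope ($0$ at isolated points). For an interval $I$ and a metric space $Y$, $\mathrm{AC}^p_{\mathrm{loc}}(I,Y)$ is the set of curves $u\colon I\to Y$ for which there is $m\in L^p_{\mathrm{loc}}(I)$ with $d(u_s,u_t)\le\int_s^t m(r)\,dr$ for all $s\le t$ in $I$. Then: (1) $(y_t)$ is a curve of maximal slope for $f$: $y\in\mathrm{AC}^1_{\mathrm{loc}}((0,T),X)$, the function $t\mapsto f(y_t)$ is in $\mathrm{AC}^1_{\mathrm{loc}}((0,T),\mathbb R)$, and for a.e. $t\in(0,T)$ the metric derivative $|\dot y_t|$ and the derivative $\frac{d}{dt}f(y_t)$ exist and $$-\frac{d}{dt}f(y_t)\ge\tfrac12|\dot y_t|^2+\tfrac12|D^-f|^2(y_t).$$ (2) $(y_t)$ satisfies the Energy Dissipation Equality: the limit $\lim_{\varepsilon\downarrow0}f(y_\varepsilon)\in(-\infty,+\infty]$ exists and $$f(y_t)+\int_0^t\Big(\tfrac12|\dot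 y_s|^2+\tfrac12|D^-f|^2(y_s)\Big)ds=\lim_{\varepsilon\downarrow0}f(y_\varepsilon)\qquad\text{for every }t\in(0,T)$$ (the limit and the integral may both be $+\infty$). (3) In particular $(y_t)$ satisfies the Energy Dissipation Inequality: $y\in\mathrm{AC}^2_{\mathrm{loc}}((0,T),X)$ and the relation in (2) holds with $\le$ in place of $=$. -/

import Mathlib

open Set Filter Topology MeasureTheory
open scoped ENNReal

noncomputable section

namespace EVINegDim

/-- The open time interval `(0, T)`, where `T ∈ (0, +∞]`. -/
def timeInterval (T : EReal) : Set ℝ := {t : ℝ | 0 < t ∧ (t : EReal) < T}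

/-- The finiteness domain of `f`. -/
def finDomain {X : Type*} (f : X → EReal) : Set X := {x | f x ≠ ⊥ ∧ f x ≠ ⊤}

/-- The extended domain of `f`, where the value `-∞` is admitted. -/
def extDomain {X : Type*} (f : X → EReal) : Set X := {x | f x < ⊤}

/-- `f_N = exp (-f / N)`, with values in `[0, +∞]`; for `N < 0` it is `0` where `f = -∞` and
`+∞` where `f = +∞`. -/
def expPot {X : Type*} (f : X → EReal) (N : ℝ) (x : X) : ℝ≥0∞ := EReal.exp (-(f x) / (N : EReal))

/-- The generalized sine function `𝔰_{K,N}` for `N < 0`. -/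
def genSin (K N θ : ℝ) : ℝ :=
  if K < 0 then Real.sin (θ * √(K / N)) / √(K / N)
  else if K = 0 then θ
  else Real.sinh (θ * √(-K / N)) / √(-K / N)

/-- Upper right derivative `limsup_{h ↓ 0} (g (t + h) - g t) / h`, as an extended real. -/
def upperRightDeriv (g : ℝ → ℝ) (t : ℝ) : EReal :=
  limsup (fun h : ℝ => (((g (t + h) - g t) / h : ℝ) : EReal)) (𝓝[>] (0 : ℝ))

/-- `EVI_{K,N}` gradient curves `(y_t)_{t ∈ (0,T)}` for `f`, with `N < 0`. Only the restriction of
`y` to `(0,T)` matters. Both `f_N (z)` and `f_N (y_t)` are finite here, and the latter is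
positive. -/
structure IsEVICurve {X : Type*} [MetricSpace X] (f : X → EReal) (K N : ℝ) (T : EReal)
    (y : ℝ → X) : Prop where
  pos : 0 < T
  continuousOn : ContinuousOn y (timeInterval T)
  mem_domain : ∀ t ∈ timeInterval T, y t ∈ finDomain f
  evi : ∀ t ∈ timeInterval T, ∀ z ∈ extDomain f,
    (K < 0 → dist (y t) z < Real.pi * √(N / K)) →
      upperRightDeriv (fun τ => genSin K N (dist (y τ) z / 2) ^ 2) t
          + ((K * genSin K N (dist (y t) z / 2) ^ 2 : ℝ) : EReal)
        ≤ ((N / 2 * (1 - (expPot f N z).toReal / (expPot f N (y t)).toReal) : ℝ) : EReal)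

/-- The class `AC^p_loc(I, X)`: there is `m ∈ L^p_loc(I)` with `d(y_s, y_t) ≤ ∫_s^t m` for all
`s ≤ t` in the interval `I`. -/
def ACLoc {X : Type*} [MetricSpace X] (p : ℝ≥0∞) (I : Set ℝ) (y : ℝ → X) : Prop :=
  ∃ m : ℝ → ℝ,
    (∀ a b : ℝ, Icc a b ⊆ I → MemLp m p (volume.restrict (Icc a b))) ∧
    ∀ s ∈ I, ∀ t ∈ I, s ≤ t → dist (y s) (y t) ≤ ∫ r in s..t, m r

/-- Difference quotients `d(y_s, y_t) / |s - t|` at `t`. -/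
def metricQuotient {X : Type*} [MetricSpace X] (y : ℝ → X) (t s : ℝ) : ℝ≥0∞ :=
  edist (y s) (y t) / edist s t

/-- The metric derivative `|ẏ_t|`; it is written as an upper limit so that it is defined
everywhere. Its existence as a limit at almost every time is part of `IsMaxSlopeCurve`. -/
def metricDeriv {X : Type*} [MetricSpace X] (y : ℝ → X) (t : ℝ) : ℝ≥0∞ :=
  limsup (metricQuotient y t) (𝓝[≠] t)

/-- The descending slope `|D⁻ f|(y) = limsup_{z → y} (f z - f y)⁻ / d(z, y)`, for `y` in the
finiteness domain; it is `0` at isolated points. Note `(f z - f y)⁻ = (f y - f z)⁺`. -/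
def descSlope {X : Type*} [MetricSpace X] (f : X → EReal) (y : X) : ℝ≥0∞ :=
  limsup (fun z => (f y - f z).toENNReal / edist z y) (𝓝[≠] y)

/-- `½ |ẏ_t|² + ½ |D⁻ f|²(y_t)`. -/
def dissipation {X : Type*} [MetricSpace X] (f : X → EReal) (y : ℝ → X) (t : ℝ) : ℝ≥0∞ :=
  metricDeriv y t ^ 2 / 2 + descSlope f (y t) ^ 2 / 2

/-- Curves of maximal slope for `f` on `(0, T)`. -/
structure IsMaxSlopeCurve {X : Type*} [MetricSpace X] (f : X → EReal) (T : EReal)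
    (y : ℝ → X) : Prop where
  mem_domain : ∀ t ∈ timeInterval T, y t ∈ finDomain f
  acLoc : ACLoc 1 (timeInterval T) y
  acLoc_energy : ACLoc 1 (timeInterval T) (fun t => (f (y t)).toReal)
  slope_le : ∀ᵐ t ∂(volume.restrict (timeInterval T)),
    Tendsto (metricQuotient y t) (𝓝[≠] t) (𝓝 (metricDeriv y t)) ∧
    ∃ e : ℝ, HasDerivAt (fun s => (f (y s)).toReal) e t ∧
      ((dissipation f y t : ℝ≥0∞) : EReal) ≤ ((-e : ℝ) : EReal)

/-- The Energy Dissipation Equality: `f(y_t) = lim_{ε ↓ 0} f(y_ε) - ∫_0^t (½|ẏ|² + ½|D⁻ f|²(y))` for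
every `t ∈ (0,T)`. The limit and the integral may both be `+∞`, so the integral is put on the
left. -/
def SatisfiesEDE {X : Type*} [MetricSpace X] (f : X → EReal) (T : EReal) (y : ℝ → X) : Prop :=
  AEMeasurable (dissipation f y) (volume.restrict (timeInterval T)) ∧
  ∃ L : EReal, Tendsto (fun ε => f (y ε)) (𝓝[>] (0 : ℝ)) (𝓝 L) ∧
    ∀ t ∈ timeInterval T,
      f (y t) + ((∫⁻ s in Ioo 0 t, dissipation f y s : ℝ≥0∞) : EReal) = L

/-- The Energy Dissipation Inequality:
`f(y_t) ≤ lim_{ε ↓ 0} f(y_ε) - ∫_0^t (½|ẏ|² + ½|D⁻ f|²(y))` for every `t ∈ (0,T)`, for a curve in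
the finiteness domain and of class `AC²_loc`. -/
def SatisfiesEDI {X : Type*} [MetricSpace X] (f : X → EReal) (T : EReal) (y : ℝ → X) : Prop :=
  (∀ t ∈ timeInterval T, y t ∈ finDomain f) ∧
  ACLoc 2 (timeInterval T) y ∧
  AEMeasurable (dissipation f y) (volume.restrict (timeInterval T)) ∧
  ∃ L : EReal, Tendsto (fun ε => f (y ε)) (𝓝[>] (0 : ℝ)) (𝓝 L) ∧
    ∀ t ∈ timeInterval T,
      f (y t) + ((∫⁻ s in Ioo 0 t, dissipation f y s : ℝ≥0∞) : EReal) ≤ L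

end EVINegDim

end

noncomputable section

namespace EVINegDim

/-! Near `0`, `𝔰(r/2)²` behaves like `r²/4`, so locally the EVI is a perturbation of the quadratic
one: the term in `K` is absorbed by a Gronwall comparison on short intervals, and `exp` is
linearised at the energy gap. Write `E(t) = f(y_t)`.

Two choices of the test point `z` carry everything. Taking `z` on the curve itself and integrating
shows that `E` is nonincreasing (`energy_antitoneOn`), that locally `d(y_s, y_t)² ≤ C (t - s) (E s -
E t)` (`exists_dist_sq_le`), and, where `E` is differentiable, that `|ẏ|² ≤ -E'`
(`eventually_dist_sq_le`). Fixing the time and letting `z` vary bounds an energy drop by the speed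
times the distance (`one_sub_exp_le`), hence `|D⁻f| ≤ |ẏ|` (`descSlope_le`). Since always `-E' ≤
|D⁻f| |ẏ|`, the chain `|ẏ|² ≤ -E' ≤ |D⁻f| |ẏ| ≤ |ẏ|²` closes, and the dissipation equals `-E'`
almost everywhere (`dissipation_eq`).

It remains to integrate, which needs `E` to have no jump and no singular part. The quadratic bound
makes `y` absolutely continuous although `E` is so far only monotone; `|ẏ|² = -E'` with `E` monotone
puts `|ẏ|` in `L²_loc`; and the energy-drop estimate, averaged in its starting time, bounds the
increments of `E` by those of an integral of a square-integrable function squared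
(`absolutelyContinuousOnInterval_of_slope_bound`). The equality on `(0, t)` follows by letting the
initial time decrease to `0`. -/

/-! ### The generalized sine near the origin. -/

lemma hasStrictDerivAt_genSin (K : ℝ) {N : ℝ} (hN : N < 0) :
    HasStrictDerivAt (genSin K N) 1 0 := by
  unfold genSin
  split_ifs with h1 h2
  · have hk : 0 < √(K / N) := Real.sqrt_pos.2 (div_pos_of_neg_of_neg h1 hN)
    have := ((Real.hasStrictDerivAt_sin (0 * √(K / N))).comp (0 : ℝ)
      ((hasStrictDerivAt_id (0 : ℝ)).mul_const √(K / N))).div_const √(K / N)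
    simpa [Function.comp_def, hk.ne'] using this
  · exact hasStrictDerivAt_id 0
  · have h3 : 0 < K := lt_of_le_of_ne (not_lt.1 h1) (Ne.symm h2)
    have hk : 0 < √(-K / N) := Real.sqrt_pos.2 (div_pos_of_neg_of_neg (by linarith) hN)
    have := ((Real.hasStrictDerivAt_sinh (0 * √(-K / N))).comp (0 : ℝ)
      ((hasStrictDerivAt_id (0 : ℝ)).mul_const √(-K / N))).div_const √(-K / N)
    simpa [Function.comp_def, hk.ne'] using this

lemma continuous_genSin (K N : ℝ) : Continuous (genSin K N) := by
  unfold genSin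
  split_ifs <;> fun_prop

@[simp] lemma genSin_zero (K N : ℝ) : genSin K N 0 = 0 := by
  simp [genSin]

/-- Near `0` the function `r ↦ 𝔰(r / 2) ^ 2` behaves like `r ^ 2 / 4`, together with its
increments. -/
lemma exists_genSin_sq_near (K : ℝ) {N : ℝ} (hN : N < 0) {ε : ℝ} (hε : 0 < ε) :
    ∃ ρ > 0, (K < 0 → ρ < Real.pi * √(N / K)) ∧
      (∀ r, 0 ≤ r → r ≤ ρ → (1 / 4 - ε) * r ^ 2 ≤ genSin K N (r / 2) ^ 2 ∧
        genSin K N (r / 2) ^ 2 ≤ r ^ 2) ∧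
      ∀ r₁ r₂, 0 ≤ r₁ → r₁ ≤ ρ → 0 ≤ r₂ → r₂ ≤ ρ →
        |genSin K N (r₁ / 2) ^ 2 - genSin K N (r₂ / 2) ^ 2| ≤
          (1 / 2 + ε) * max r₁ r₂ * |r₁ - r₂| := by
  -- This `η` makes both `(1 - η)²/4 ≥ 1/4 - ε` and `(1 + η)²/2 ≤ 1/2 + ε`.
  obtain ⟨η, hη, hη1, hηε⟩ : ∃ η > 0, η ≤ 1 ∧ η ≤ ε / 2 :=
    ⟨min 1 (ε / 2), by positivity, min_le_left _ _, min_le_right _ _⟩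
  have h0 := (hasStrictDerivAt_genSin K hN).hasStrictFDerivAt.isLittleO.def hη
  obtain ⟨ρ₀, hρ₀, hball⟩ := Metric.eventually_nhds_iff.1 h0
  have hinc : ∀ a b, |a| < ρ₀ → |b| < ρ₀ →
      |genSin K N a - genSin K N b - (a - b)| ≤ η * |a - b| := by
    intro a b ha hb
    have := @hball (a, b) (by simp [Prod.dist_eq, ha, hb])
    simpa using this
  obtain ⟨ρ₁, hρ₁, hρK⟩ : ∃ ρ₁ > 0, (K < 0 → ρ₁ < Real.pi * √(N / K)) := by
    by_cases hK : K < 0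
    · have : 0 < Real.pi * √(N / K) :=
        mul_pos Real.pi_pos (Real.sqrt_pos.2 (div_pos_of_neg_of_neg hN hK))
      exact ⟨Real.pi * √(N / K) / 2, by positivity, fun _ => by linarith⟩
    · exact ⟨1, one_pos, fun h => absurd h hK⟩
  have hS : ∀ r, 0 ≤ r → r ≤ min ρ₀ ρ₁ →
      (1 - η) * (r / 2) ≤ genSin K N (r / 2) ∧ genSin K N (r / 2) ≤ (1 + η) * (r / 2) := by
    intro r hr hr'
    have hr'' := hr'.trans (min_le_left _ _)
    have h := hinc (r / 2) 0 (by rw [abs_of_nonneg (by positivity)]; linarith)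
      (by simpa using hρ₀)
    rw [genSin_zero, sub_zero, sub_zero, abs_of_nonneg (show 0 ≤ r / 2 by positivity),
      abs_le] at h
    constructor <;> nlinarith [h.1, h.2]
  refine ⟨min ρ₀ ρ₁, lt_min hρ₀ hρ₁, fun hK => (min_le_right _ _).trans_lt (hρK hK), ?_, ?_⟩
  · intro r hr hr'
    obtain ⟨h1, h2⟩ := hS r hr hr'
    have h3 : 0 ≤ (1 - η) * (r / 2) := mul_nonneg (by linarith) (by linarith)
    have h4 : ((1 - η) * (r / 2)) ^ 2 ≤ genSin K N (r / 2) ^ 2 := pow_le_pow_left₀ h3 h1 2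
    have h5 : genSin K N (r / 2) ^ 2 ≤ ((1 + η) * (r / 2)) ^ 2 :=
      pow_le_pow_left₀ (h3.trans h1) h2 2
    have h6 := sq_nonneg r
    constructor
    · refine le_trans ?_ h4
      have : 1 / 4 - ε ≤ (1 - η) ^ 2 / 4 := by nlinarith
      calc _ ≤ (1 - η) ^ 2 / 4 * r ^ 2 := by gcongr
        _ = _ := by ring
    · refine h5.trans ?_
      have : (1 + η) ^ 2 / 4 ≤ 1 := by nlinarith
      calc ((1 + η) * (r / 2)) ^ 2 = (1 + η) ^ 2 / 4 * r ^ 2 := by ring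
        _ ≤ 1 * r ^ 2 := by gcongr
        _ = _ := one_mul _
  · intro r₁ r₂ hr₁ hr₁' hr₂ hr₂'
    obtain ⟨h1, h2⟩ := hS r₁ hr₁ hr₁'
    obtain ⟨h3, h4⟩ := hS r₂ hr₂ hr₂'
    have h5 : 0 ≤ (1 - η) * (r₁ / 2) := mul_nonneg (by linarith) (by linarith)
    have h6 : 0 ≤ (1 - η) * (r₂ / 2) := mul_nonneg (by linarith) (by linarith)
    have hm := min_le_left ρ₀ ρ₁
    have h := hinc (r₁ / 2) (r₂ / 2) (by rw [abs_of_nonneg (by positivity)]; linarith)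
      (by rw [abs_of_nonneg (by positivity)]; linarith)
    have hd : |genSin K N (r₁ / 2) - genSin K N (r₂ / 2)| ≤ (1 + η) * (|r₁ - r₂| / 2) := by
      have e : |r₁ / 2 - r₂ / 2| = |r₁ - r₂| / 2 := by
        rw [← sub_div, abs_div, abs_two]
      have := abs_sub_abs_le_abs_sub (genSin K N (r₁ / 2) - genSin K N (r₂ / 2))
        (r₁ / 2 - r₂ / 2)
      rw [e] at this h
      linarith
    have hs : genSin K N (r₁ / 2) + genSin K N (r₂ / 2) ≤ (1 + η) * max r₁ r₂ := by
      have := le_max_left r₁ r₂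
      have := le_max_right r₁ r₂
      nlinarith
    have hm0 : 0 ≤ max r₁ r₂ := hr₁.trans (le_max_left _ _)
    have hη2 : (1 + η) ^ 2 / 2 ≤ 1 / 2 + ε := by nlinarith
    calc |genSin K N (r₁ / 2) ^ 2 - genSin K N (r₂ / 2) ^ 2|
        = (genSin K N (r₁ / 2) + genSin K N (r₂ / 2)) *
          |genSin K N (r₁ / 2) - genSin K N (r₂ / 2)| := by
          rw [sq_sub_sq, abs_mul, abs_of_nonneg (by linarith)]
      _ ≤ ((1 + η) * max r₁ r₂) * ((1 + η) * (|r₁ - r₂| / 2)) := by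
          gcongr
      _ = (1 + η) ^ 2 / 2 * (max r₁ r₂ * |r₁ - r₂|) := by ring
      _ ≤ (1 / 2 + ε) * (max r₁ r₂ * |r₁ - r₂|) := by gcongr
      _ = _ := by ring

/-! ### Comparison for Dini derivatives. -/

lemma abs_mul_le_half_of_le {K r : ℝ} (hr : r ≤ 1 / (2 * (|K| + 1))) (hr0 : 0 ≤ r) :
    |K| * r ≤ 1 / 2 := by
  have : (|K| + 1) * r ≤ 1 / 2 := by
    calc (|K| + 1) * r ≤ (|K| + 1) * (1 / (2 * (|K| + 1))) := by gcongr
      _ = 1 / 2 := by field_simp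
  linarith

/-- Comparison for upper right Dini derivatives, on an interval that is short in terms of `k`. -/
lemma le_of_dini_le {g : ℝ → ℝ} {a b c k κ κ' : ℝ} (hk : 0 ≤ k) (hc : 0 ≤ c) (hκ : 0 ≤ κ')
    (hg : ContinuousOn g (Icc a b)) (ha : g a ≤ 0) (h1 : k * (b - a) ≤ 1 / 2)
    (h2 : k * (b - a) * κ' / 2 ≤ κ' - κ)
    (hd : ∀ x ∈ Ico a b, ∀ q, k * g x + c + κ * (x - a) < q →
      ∀ᶠ h in 𝓝[>] (0 : ℝ), (g (x + h) - g x) / h < q) :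
    ∀ x ∈ Icc a b, g x ≤ 2 * c * (x - a) + κ' * (x - a) ^ 2 / 2 := by
  intro x hx
  -- The barrier has the extra slope `η` so that its derivative strictly exceeds that of `g` at a
  -- contact point. There `k * g` uses at most half of `2 * c + η`, by `h1`, and at most the gap `κ'
  -- - κ` in the slope coefficient, by `h2`.
  have key : ∀ η > 0, g x ≤ (2 * c + η) * (x - a) + κ' * (x - a) ^ 2 / 2 := by
    intro η hη
    refine image_le_of_liminf_slope_right_lt_deriv_boundary
      (B := fun x => (2 * c + η) * (x - a) + κ' * (x - a) ^ 2 / 2)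
      (B' := fun x => 2 * c + η + κ' * (x - a))
      (f' := fun x => k * g x + c + κ * (x - a)) hg ?_ (by simpa using ha) ?_ ?_ hx
    · intro x hx q hq
      have h := hd x hx q hq
      have ht : Tendsto (fun z => z - x) (𝓝[>] x) (𝓝[>] (0 : ℝ)) := by
        refine tendsto_nhdsWithin_iff.2 ⟨?_, ?_⟩
        · have : Tendsto (fun z => z - x) (𝓝 x) (𝓝 (x - x)) :=
            (continuous_id.sub continuous_const).tendsto x
          rw [sub_self] at this
          exact this.mono_left nhdsWithin_le_nhds
        · filter_upwards [self_mem_nhdsWithin] with z hz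
          exact sub_pos.2 (mem_Ioi.1 hz)
      refine ((ht.eventually h).mono fun z hz => ?_).frequently
      rw [slope_def_field]
      simpa using hz
    · intro x
      have h3 : HasDerivAt (fun x => x - a) 1 x := (hasDerivAt_id x).sub_const a
      have := (h3.const_mul (2 * c + η)).add (((h3.pow 2).const_mul κ').div_const 2)
      convert! this using 1
      simp; ring
    · intro x hx he
      have hxa : 0 ≤ x - a := sub_nonneg.2 hx.1
      have hxb : x - a ≤ b - a := by linarith [hx.2]
      rw [he]
      have h4 : k * (x - a) ≤ 1 / 2 := le_trans (by gcongr) h1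
      have h5 : k * (x - a) * κ' / 2 ≤ κ' - κ := le_trans (by gcongr) h2
      have h6 : (2 * c + η) * (k * (x - a)) ≤ (2 * c + η) * (1 / 2) := by gcongr
      have h7 : (k * (x - a) * κ' / 2) * (x - a) ≤ (κ' - κ) * (x - a) := by gcongr
      nlinarith
  refine le_of_forall_pos_le_add fun ε hε => ?_
  have hxa : 0 ≤ x - a := sub_nonneg.2 hx.1
  have h := key (ε / (x - a + 1)) (by positivity)
  have h3 : ε / (x - a + 1) * (x - a) ≤ ε := by
    rw [div_mul_eq_mul_div, div_le_iff₀ (by positivity)]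
    nlinarith
  nlinarith

lemma tendsto_add_nhdsGT_zero (t : ℝ) :
    Tendsto (fun h => t + h) (𝓝[>] (0 : ℝ)) (𝓝[≠] t) := by
  refine tendsto_nhdsWithin_iff.2 ⟨?_, ?_⟩
  · have : Tendsto (fun h => t + h) (𝓝 (0 : ℝ)) (𝓝 (t + 0)) :=
      (continuous_const.add continuous_id).tendsto 0
    rw [add_zero] at this
    exact this.mono_left nhdsWithin_le_nhds
  · filter_upwards [self_mem_nhdsWithin] with h hh
    have : 0 < h := hh
    simpa using this.ne'

lemma isOpen_timeInterval (T : EReal) : IsOpen (timeInterval T) :=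
  isOpen_Ioi.inter (isOpen_Iio.preimage continuous_coe_real_ereal)

lemma Icc_subset_timeInterval {T : EReal} {a b : ℝ} (ha : 0 < a) (hb : (b : EReal) < T) :
    Icc a b ⊆ timeInterval T := fun _ hx =>
  ⟨ha.trans_le hx.1, (EReal.coe_le_coe_iff.2 hx.2).trans_lt hb⟩

lemma Icc_subset_timeInterval_of_mem {T : EReal} {a b : ℝ} (ha : a ∈ timeInterval T)
    (hb : b ∈ timeInterval T) : Icc a b ⊆ timeInterval T :=
  Icc_subset_timeInterval ha.1 hb.2

/-! ### The EVI in real-valued form. -/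

/-- The real-valued energy along the curve. -/
def energy {X : Type*} (f : X → EReal) (y : ℝ → X) (t : ℝ) : ℝ := (f (y t)).toReal

lemma expPot_toReal {X : Type*} {f : X → EReal} {z : X} {e : ℝ} (h : f z = e) (N : ℝ) :
    (expPot f N z).toReal = Real.exp (-e / N) := by
  rw [expPot, h, ← EReal.coe_neg, ← EReal.coe_div, EReal.exp_coe,
    ENNReal.toReal_ofReal (Real.exp_pos _).le]

variable {X : Type*} [MetricSpace X] {f : X → EReal} {K N : ℝ} {T : EReal} {y : ℝ → X}

/-- The function `τ ↦ 𝔰(d(y_τ, z) / 2) ^ 2` of the evolution variational inequality. -/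
def halfDistSq (K N : ℝ) (y : ℝ → X) (z : X) (τ : ℝ) : ℝ := genSin K N (dist (y τ) z / 2) ^ 2

lemma halfDistSq_nonneg (z : X) (τ : ℝ) : 0 ≤ halfDistSq K N y z τ := sq_nonneg _

@[simp] lemma halfDistSq_self (τ : ℝ) : halfDistSq K N y (y τ) τ = 0 := by
  simp [halfDistSq]

namespace IsEVICurve

lemma coe_energy (hy : IsEVICurve f K N T y) {t : ℝ} (ht : t ∈ timeInterval T) :
    f (y t) = (energy f y t : EReal) :=
  (EReal.coe_toReal (hy.mem_domain t ht).2 (hy.mem_domain t ht).1).symm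

lemma continuousAt (hy : IsEVICurve f K N T y) {t : ℝ} (ht : t ∈ timeInterval T) :
    ContinuousAt y t :=
  hy.continuousOn.continuousAt ((isOpen_timeInterval T).mem_nhds ht)

lemma continuousOn_halfDistSq (hy : IsEVICurve f K N T y) (z : X) :
    ContinuousOn (halfDistSq K N y z) (timeInterval T) := by
  have := hy.continuousOn
  have h := continuous_genSin K N
  unfold halfDistSq
  fun_prop

lemma eventually_quotient_lt (hy : IsEVICurve f K N T y) {t : ℝ} (ht : t ∈ timeInterval T)
    {z : X} {e : ℝ} (hz : f z = e) (hd : K < 0 → dist (y t) z < Real.pi * √(N / K)) {q : ℝ}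
    (hq : N / 2 * (1 - Real.exp ((energy f y t - e) / N)) - K * halfDistSq K N y z t < q) :
    ∀ᶠ h in 𝓝[>] (0 : ℝ), (halfDistSq K N y z (t + h) - halfDistSq K N y z t) / h < q := by
  have h := hy.evi t ht z (by simp [extDomain, hz]) hd
  rw [expPot_toReal hz, expPot_toReal (hy.coe_energy ht), ← Real.exp_sub] at h
  have e1 : -e / N - -energy f y t / N = (energy f y t - e) / N := by ring
  rw [e1] at h
  have h2 : upperRightDeriv (halfDistSq K N y z) t < (q : EReal) := by
    have h3 := EReal.le_sub_iff_add_le (c := ((N / 2 * (1 - Real.exp ((energy f y t - e) / N)) :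
      ℝ) : EReal)) (b := ((K * halfDistSq K N y z t : ℝ) : EReal))
      (a := upperRightDeriv (halfDistSq K N y z) t) (Or.inl (EReal.coe_ne_bot _))
      (Or.inl (EReal.coe_ne_top _))
    refine (h3.2 h).trans_lt ?_
    rw [← EReal.coe_sub]
    exact EReal.coe_lt_coe_iff.2 hq
  filter_upwards [eventually_lt_of_limsup_lt h2] with h hh
  exact EReal.coe_lt_coe_iff.1 hh

lemma eventually_quotient_lt_energy (hy : IsEVICurve f K N T y) {s t : ℝ}
    (hs : s ∈ timeInterval T) (ht : t ∈ timeInterval T)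
    (hd : K < 0 → dist (y t) (y s) < Real.pi * √(N / K)) {q : ℝ}
    (hq : |K| * halfDistSq K N y (y s) t
      + N / 2 * (1 - Real.exp ((energy f y t - energy f y s) / N)) < q) :
    ∀ᶠ h in 𝓝[>] (0 : ℝ),
      (halfDistSq K N y (y s) (t + h) - halfDistSq K N y (y s) t) / h < q := by
  refine hy.eventually_quotient_lt ht (hy.coe_energy hs) hd (lt_of_le_of_lt ?_ hq)
  have := mul_le_mul_of_nonneg_right (neg_le_abs K)
    (halfDistSq_nonneg (K := K) (N := N) (y := y) (y s) t)
  linarith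

/-! ### Testing the EVI along the curve: monotone energy and distance bounds. -/

/-- If the energy rose above a level `c`, lower semicontinuity would give a last time `a` in the
interval with energy at most `c`. After `a` the energy exceeds `E a`, so the EVI with `z = y a` has
a nonpositive source and freezes the curve at `y a`, contradicting the choice of `a`. -/
lemma energy_antitoneOn (hf : LowerSemicontinuous f) (hN : N < 0) (hy : IsEVICurve f K N T y) :
    AntitoneOn (energy f y) (timeInterval T) := by
  intro s hs t ht hst
  by_contra! hlt
  obtain ⟨c, hsc, hct⟩ := exists_between hlt
  have hI := Icc_subset_timeInterval_of_mem hs ht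
  have hcl : IsClosed (Icc s t ∩ y ⁻¹' {x | f x ≤ (c : EReal)}) :=
    (hy.continuousOn.mono hI).preimage_isClosed_of_isClosed isClosed_Icc
      (hf.isClosed_preimage (c : EReal))
  obtain ⟨a, ⟨haI, hac⟩, hmax⟩ :=
    (isCompact_Icc.of_isClosed_subset hcl inter_subset_left).exists_isGreatest
      ⟨s, left_mem_Icc.2 hst, by
        simpa [hy.coe_energy hs] using hsc.le⟩
  have haT := hI haI
  have hac' : energy f y a ≤ c := by simpa [hy.coe_energy haT] using hac
  have hat : a < t := lt_of_le_of_ne haI.2 (by rintro rfl; linarith)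
  have hgt : ∀ x, a < x → x ≤ t → c < energy f y x := by
    intro x hax hxt
    by_contra! hle
    have hxI : x ∈ Icc s t := ⟨haI.1.trans hax.le, hxt⟩
    exact absurd (hmax ⟨hxI, by simpa [hy.coe_energy (hI hxI)] using hle⟩) (not_le.2 hax)
  -- With `ε = 1/8` the lower coefficient `1/4 - ε` is positive, which is all that is needed here.
  obtain ⟨ρ, hρ, hρK, hρ2, -⟩ := exists_genSin_sq_near K hN (show (0 : ℝ) < 1 / 8 by norm_num)
  obtain ⟨δ, hδ, hball⟩ := Metric.continuousAt_iff.1 (hy.continuousAt haT) ρ hρ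
  set r := min (t - a) (min (δ / 2) (1 / (2 * (|K| + 1)))) with hr
  have hr0 : 0 < r := lt_min (by linarith) (lt_min (by linarith) (by positivity))
  have hr1 : r ≤ t - a := min_le_left _ _
  have hr2 : r ≤ δ / 2 := (min_le_right _ _).trans (min_le_left _ _)
  have hr3 : r ≤ 1 / (2 * (|K| + 1)) := (min_le_right _ _).trans (min_le_right _ _)
  have hsub : Icc a (a + r) ⊆ timeInterval T := fun x hx =>
    hI ⟨haI.1.trans hx.1, by linarith [hx.2]⟩
  have hdist : ∀ x ∈ Icc a (a + r), dist (y x) (y a) < ρ := fun x hx =>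
    hball (by rw [Real.dist_eq, abs_of_nonneg (by linarith [hx.1])]; linarith [hx.2])
  have hcmp := le_of_dini_le (g := halfDistSq K N y (y a)) (a := a) (b := a + r) (c := 0)
    (k := |K|) (κ := 0) (κ' := 0) (abs_nonneg K) le_rfl le_rfl
    ((hy.continuousOn_halfDistSq _).mono hsub) (by simp)
    (by simpa using abs_mul_le_half_of_le hr3 hr0.le)
    (by simp)
    (by
      intro x hx q hq
      have hx' := Ico_subset_Icc_self hx
      refine hy.eventually_quotient_lt_energy haT (hsub hx')
        (fun hK => (hdist x hx').trans (hρK hK)) (lt_of_le_of_lt ?_ hq)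
      have hle : energy f y a ≤ energy f y x := by
        rcases hx'.1.eq_or_lt with rfl | h
        · exact le_rfl
        · linarith [hgt x h (by linarith [hx.2])]
      have : Real.exp ((energy f y x - energy f y a) / N) ≤ 1 :=
        Real.exp_le_one_iff.2 (div_nonpos_of_nonneg_of_nonpos (by linarith) hN.le)
      nlinarith)
  have hend : a + r ∈ Icc a (a + r) := right_mem_Icc.2 (by linarith)
  have hg := hcmp (a + r) hend
  have hlow := (hρ2 _ dist_nonneg (hdist _ hend).le).1
  have hd0 : dist (y (a + r)) (y a) = 0 := by
    have : halfDistSq K N y (y a) (a + r) = genSin K N (dist (y (a + r)) (y a) / 2) ^ 2 := rfl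
    rw [this] at hg
    have h5 : dist (y (a + r)) (y a) ^ 2 ≤ 0 := by linarith
    exact pow_eq_zero_iff two_ne_zero |>.1 (le_antisymm h5 (sq_nonneg _))
  have h6 : energy f y (a + r) = energy f y a := by
    unfold energy; rw [dist_eq_zero.1 hd0]
  linarith [hgt (a + r) (by linarith) (by linarith)]

lemma exists_forall_dist_lt (hy : IsEVICurve f K N T y) {a b : ℝ} (hab : Icc a b ⊆ timeInterval T)
    {ρ : ℝ} (hρ : 0 < ρ) :
    ∃ δ > 0, ∀ s ∈ Icc a b, ∀ t ∈ Icc a b, |s - t| < δ → dist (y s) (y t) < ρ := by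
  have := isCompact_Icc.uniformContinuousOn_of_continuous (hy.continuousOn.mono hab)
  obtain ⟨δ, hδ, h⟩ := Metric.uniformContinuousOn_iff.1 this ρ hρ
  exact ⟨δ, hδ, fun s hs t ht hst => h s hs t ht (by rwa [Real.dist_eq])⟩

/-- Test with `z = y s`. By monotonicity the source at each `x` in `[s, t]` is at most its value at
`t`, which is comparable to `E s - E t`; integrating over `[s, t]` supplies the factor `t - s`. -/
lemma exists_dist_sq_le (hf : LowerSemicontinuous f) (hN : N < 0) (hy : IsEVICurve f K N T y)
    {a b : ℝ} (hab : Icc a b ⊆ timeInterval T) :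
    ∃ C > 0, ∃ δ > 0, ∀ s ∈ Icc a b, ∀ t ∈ Icc a b, s ≤ t → t - s ≤ δ →
      dist (y s) (y t) ^ 2 ≤ C * (t - s) * (energy f y s - energy f y t) := by
  obtain ⟨ρ, hρ, hρK, hρ2, -⟩ := exists_genSin_sq_near K hN (show (0 : ℝ) < 1 / 8 by norm_num)
  obtain ⟨δ, hδ, hball⟩ := hy.exists_forall_dist_lt hab hρ
  have hanti := hy.energy_antitoneOn hf hN
  -- The `8` inverts the coefficient `1/4 - 1/8`; the exponential bounds `exp v` over all energy
  -- gaps in `[a, b]`.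
  refine ⟨8 * Real.exp ((energy f y b - energy f y a) / N), by positivity,
    min (δ / 2) (1 / (2 * (|K| + 1))), lt_min (by linarith) (by positivity), ?_⟩
  intro s hs t ht hst hδ'
  have hr2 : t - s ≤ δ / 2 := hδ'.trans (min_le_left _ _)
  have hr3 : t - s ≤ 1 / (2 * (|K| + 1)) := hδ'.trans (min_le_right _ _)
  have hsub : Icc s t ⊆ Icc a b := Icc_subset_Icc hs.1 ht.2
  have hdist : ∀ x ∈ Icc s t, dist (y x) (y s) < ρ := fun x hx =>
    hball x (hsub hx) s hs
      (by rw [abs_of_nonneg (by linarith [hx.1])]; linarith [hx.2])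
  have hEst := hanti (hab hs) (hab ht) hst
  have hEbt := hanti (hab ht) (hab (right_mem_Icc.2 (hs.1.trans hs.2))) ht.2
  have hEsa := hanti (hab (left_mem_Icc.2 (hs.1.trans hs.2))) (hab hs) hs.1
  set v := (energy f y t - energy f y s) / N with hv
  have hv0 : 0 ≤ v := div_nonneg_of_nonpos (by linarith) hN.le
  have hc : 0 ≤ N / 2 * (1 - Real.exp v) := by
    have := Real.one_le_exp hv0
    nlinarith
  have hcmp := le_of_dini_le (g := halfDistSq K N y (y s)) (a := s) (b := t)
    (c := N / 2 * (1 - Real.exp v))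
    (k := |K|) (κ := 0) (κ' := 0) (abs_nonneg K) hc le_rfl
    ((hy.continuousOn_halfDistSq _).mono (hsub.trans hab)) (by simp)
    (abs_mul_le_half_of_le hr3 (by linarith)) (by simp)
    (by
      intro x hx q hq
      have hx' := Ico_subset_Icc_self hx
      refine hy.eventually_quotient_lt_energy (hab hs) (hab (hsub hx'))
        (fun hK => (hdist x hx').trans (hρK hK)) (lt_of_le_of_lt ?_ hq)
      have hle : energy f y t ≤ energy f y x := hanti (hab (hsub hx')) (hab ht) hx'.2
      have : Real.exp ((energy f y x - energy f y s) / N) ≤ Real.exp v :=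
        Real.exp_le_exp.2 (div_le_div_of_nonpos_of_le hN.le (by linarith))
      nlinarith)
  have hg := hcmp t (right_mem_Icc.2 hst)
  have hlow := (hρ2 _ dist_nonneg (hdist _ (right_mem_Icc.2 hst)).le).1
  have he : halfDistSq K N y (y s) t = genSin K N (dist (y t) (y s) / 2) ^ 2 := rfl
  rw [he] at hg
  have hexp : Real.exp v ≤ Real.exp ((energy f y b - energy f y a) / N) :=
    Real.exp_le_exp.2 (div_le_div_of_nonpos_of_le hN.le (by linarith))
  have hexp2 : Real.exp v - 1 ≤ v * Real.exp v := by
    have h1 := Real.add_one_le_exp (-v)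
    have h2 : Real.exp (-v) * Real.exp v = 1 := by rw [← Real.exp_add]; simp
    nlinarith [Real.exp_pos v]
  have hNv : -N * v = energy f y s - energy f y t := by
    have hN0 : N ≠ 0 := hN.ne
    rw [hv]; field_simp; ring
  have hc2 : N / 2 * (1 - Real.exp v) ≤
      (energy f y s - energy f y t) / 2 * Real.exp ((energy f y b - energy f y a) / N) := by
    calc N / 2 * (1 - Real.exp v) = -N / 2 * (Real.exp v - 1) := by ring
      _ ≤ -N / 2 * (v * Real.exp v) := by
          gcongr
          linarith
      _ = (energy f y s - energy f y t) / 2 * Real.exp v := by rw [← hNv]; ring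
      _ ≤ _ := by gcongr
  have hts : 0 ≤ t - s := by linarith
  have := mul_le_mul_of_nonneg_right hc2 hts
  rw [dist_comm]
  nlinarith

/-- The sharp form at a point of differentiability: the source grows like `-e'/2 * (τ - t)`, so
`𝔰(d/2)² ≈ d²/4` is at most about `-e'/4 * h²`. This yields `|ẏ|² ≤ -E'`. -/
lemma eventually_dist_sq_le (hN : N < 0) (hy : IsEVICurve f K N T y)
    {t : ℝ} (ht : t ∈ timeInterval T) {e' : ℝ} (he : HasDerivAt (energy f y) e' t)
    {c : ℝ} (hc0 : 0 < c) (hc : -e' < c) :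
    ∀ᶠ h in 𝓝[>] (0 : ℝ), dist (y (t + h)) (y t) ^ 2 ≤ c * h ^ 2 := by
  obtain ⟨κ, hκ1, hκ2⟩ := exists_between (show -e' / 2 < c / 2 by linarith)
  obtain ⟨κ', hκ'1, hκ'2⟩ := exists_between (show max κ 0 < c / 2 from max_lt hκ2 (by linarith))
  have hκ'κ : κ < κ' := (le_max_left _ _).trans_lt hκ'1
  have hκ'0 : 0 < κ' := (le_max_right _ _).trans_lt hκ'1
  -- Chosen so that `1/4 - ε = κ' / (2 * c)`, which turns the bound `κ' * h² / 2` into exactly `c *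
  -- h²`.
  obtain ⟨ρ, hρ, hρK, hρ2, -⟩ := exists_genSin_sq_near K hN
    (show 0 < (c / 2 - κ') / (2 * c) by apply div_pos <;> linarith)
  have hbeta : HasDerivAt (fun τ => N / 2 * (1 - Real.exp ((energy f y τ - energy f y t) / N)))
      (-e' / 2) t := by
    have := ((((he.sub_const (energy f y t)).div_const N).exp).const_sub 1).const_mul (N / 2)
    convert! this using 1
    have hN0 : N ≠ 0 := hN.ne
    simp
    field_simp
  have hbeta2 : ∀ᶠ τ in 𝓝 t, t < τ →
      N / 2 * (1 - Real.exp ((energy f y τ - energy f y t) / N)) ≤ κ * (τ - t) := by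
    have h1 := hasDerivAt_iff_tendsto_slope.1 hbeta
    have h2 := h1.eventually (eventually_lt_nhds hκ1)
    rw [eventually_nhdsWithin_iff] at h2
    filter_upwards [h2] with τ hτ hτt
    have h3 := hτ (ne_of_gt hτt)
    rw [slope_def_field, div_lt_iff₀ (sub_pos.2 hτt)] at h3
    simpa using h3.le
  have hcont : ∀ᶠ τ in 𝓝 t, dist (y τ) (y t) < ρ :=
    (hy.continuousAt ht).eventually (Metric.ball_mem_nhds _ hρ)
  obtain ⟨δ, hδ, hball⟩ := Metric.eventually_nhds_iff.1
    ((hbeta2.and hcont).and ((isOpen_timeInterval T).mem_nhds ht))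
  have hδ' : 0 < min δ (min (1 / (2 * (|K| + 1))) ((κ' - κ) / ((|K| + 1) * κ'))) :=
    lt_min hδ (lt_min (by positivity) (div_pos (by linarith) (by positivity)))
  filter_upwards [Ioo_mem_nhdsGT hδ'] with h hh
  have hhδ : h < δ := hh.2.trans_le (min_le_left _ _)
  have hh1 : h ≤ 1 / (2 * (|K| + 1)) :=
    hh.2.le.trans ((min_le_right _ _).trans (min_le_left _ _))
  have hh2 : h ≤ (κ' - κ) / ((|K| + 1) * κ') :=
    hh.2.le.trans ((min_le_right _ _).trans (min_le_right _ _))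
  have hloc : ∀ x ∈ Icc t (t + h), (t < x →
      N / 2 * (1 - Real.exp ((energy f y x - energy f y t) / N)) ≤ κ * (x - t)) ∧
      dist (y x) (y t) < ρ ∧ x ∈ timeInterval T := by
    intro x hx
    have := @hball x (by
      rw [Real.dist_eq, abs_of_nonneg (by linarith [hx.1])]; linarith [hx.2])
    exact ⟨this.1.1, this.1.2, this.2⟩
  have hcmp := le_of_dini_le (g := halfDistSq K N y (y t)) (a := t) (b := t + h)
    (c := 0) (k := |K|) (κ := κ) (κ' := κ') (abs_nonneg K) le_rfl hκ'0.le
    ((hy.continuousOn_halfDistSq _).mono fun x hx => (hloc x hx).2.2) (by simp)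
    (by simpa using abs_mul_le_half_of_le hh1 hh.1.le)
    (by
      rw [le_div_iff₀ (by positivity)] at hh2
      have : 0 ≤ h * κ' := mul_nonneg hh.1.le hκ'0.le
      have := mul_nonneg (abs_nonneg K) this
      nlinarith [hh.1])
    (by
      intro x hx q hq
      have hx' := Ico_subset_Icc_self hx
      obtain ⟨h1, h2, h3⟩ := hloc x hx'
      refine hy.eventually_quotient_lt_energy ht h3 (fun hK => h2.trans (hρK hK))
        (lt_of_le_of_lt ?_ hq)
      rcases hx'.1.eq_or_lt with rfl | h4
      · simp
      · linarith [h1 h4])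
  have hend : t + h ∈ Icc t (t + h) := right_mem_Icc.2 (by linarith [hh.1])
  have hg := hcmp _ hend
  have hlow := (hρ2 _ dist_nonneg (hloc _ hend).2.1.le).1
  have heq : halfDistSq K N y (y t) (t + h) = genSin K N (dist (y (t + h)) (y t) / 2) ^ 2 := rfl
  rw [heq] at hg
  have hcoef : 1 / 4 - (c / 2 - κ') / (2 * c) = κ' / (2 * c) := by field_simp; ring
  rw [hcoef] at hlow
  have h5 : κ' / (2 * c) * dist (y (t + h)) (y t) ^ 2 ≤ κ' / (2 * c) * (c * h ^ 2) := by
    calc _ ≤ _ := hlow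
      _ ≤ _ := hg
      _ = _ := by field_simp; ring
  exact le_of_mul_le_mul_left h5 (by positivity)

/-! ### Testing the EVI at nearby points: energy drops and the slope. -/

/-- By the triangle inequality a curve of speed `σ` approaches `z` at rate at most `σ`, so the
difference quotients of `𝔰(d/2)²` are at least about `-(1/2 + ε) * r * σ`, while the EVI bounds them
above. The EVI holds for all small `h`, so the speed bound is only needed for arbitrarily small `h`.
-/
lemma one_sub_exp_le (hy : IsEVICurve f K N T y) {ε ρ : ℝ}
    (hε : 0 < ε)
    (hρK : K < 0 → ρ < Real.pi * √(N / K))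
    (hρ1 : ∀ r, 0 ≤ r → r ≤ ρ → genSin K N (r / 2) ^ 2 ≤ r ^ 2)
    (hρ2 : ∀ r₁ r₂, 0 ≤ r₁ → r₁ ≤ ρ → 0 ≤ r₂ → r₂ ≤ ρ →
        |genSin K N (r₁ / 2) ^ 2 - genSin K N (r₂ / 2) ^ 2| ≤
          (1 / 2 + ε) * max r₁ r₂ * |r₁ - r₂|)
    {s : ℝ} (hs : s ∈ timeInterval T) {σ : ℝ}
    (hσ : ∃ᶠ h in 𝓝[>] (0 : ℝ), dist (y (s + h)) (y s) ≤ σ * h)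
    {z : X} {e : ℝ} (hz : f z = e) (hd : dist (y s) z < ρ) :
    -N / 2 * (1 - Real.exp ((energy f y s - e) / N)) ≤
      |K| * dist (y s) z ^ 2 + (1 / 2 + ε) * dist (y s) z * σ := by
  set r := dist (y s) z with hr
  have hr0 : 0 ≤ r := dist_nonneg
  have hdK : K < 0 → r < Real.pi * √(N / K) := fun hK => hd.trans (hρK hK)
  have hG : halfDistSq K N y z s ≤ r ^ 2 := hρ1 r hr0 hd.le
  have hKG : -K * halfDistSq K N y z s ≤ |K| * r ^ 2 :=
    mul_le_mul (neg_le_abs K) hG (halfDistSq_nonneg _ _) (abs_nonneg K)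
  by_contra! hcon
  have hlt : N / 2 * (1 - Real.exp ((energy f y s - e) / N)) - K * halfDistSq K N y z s
      < -((1 / 2 + ε) * r * σ) := by linarith
  obtain ⟨q, hq1, hq2⟩ := exists_between hlt
  have hev := hy.eventually_quotient_lt hs hz hdK hq1
  have hcont : Tendsto (fun h => dist (y (s + h)) z) (𝓝[>] (0 : ℝ)) (𝓝 r) := by
    have h1 : ContinuousAt (fun h => dist (y (s + h)) z) 0 := by
      have h2 : ContinuousAt y (s + 0) := by simpa using hy.continuousAt hs
      have h3 : ContinuousAt (fun h : ℝ => s + h) 0 := by fun_prop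
      exact (ContinuousAt.comp (f := fun h : ℝ => s + h) h2 h3).dist continuousAt_const
    have := h1.tendsto
    simp only [add_zero] at this
    exact this.mono_left nhdsWithin_le_nhds
  have hmax : Tendsto (fun h => -((1 / 2 + ε) * max (dist (y (s + h)) z) r * σ)) (𝓝[>] (0 : ℝ))
      (𝓝 (-((1 / 2 + ε) * max r r * σ))) :=
    (((hcont.max tendsto_const_nhds).const_mul _).mul_const _).neg
  rw [max_self] at hmax
  have hev2 := hmax.eventually (eventually_gt_nhds hq2)
  have hev3 := hcont.eventually (eventually_lt_nhds hd)
  obtain ⟨h, h1, h2, h3, h4, h5⟩ := (hσ.and_eventually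
    (hev.and (hev2.and (hev3.and self_mem_nhdsWithin)))).exists
  have h5' : 0 < h := h5
  rw [div_lt_iff₀ h5'] at h2
  have h6 := hρ2 (dist (y (s + h)) z) r dist_nonneg h4.le hr0 hd.le
  have h7 : |dist (y (s + h)) z - r| ≤ dist (y (s + h)) (y s) := abs_dist_sub_le _ _ _
  have h8 : 0 ≤ max (dist (y (s + h)) z) r := hr0.trans (le_max_right _ _)
  have h9 : |halfDistSq K N y z (s + h) - halfDistSq K N y z s| ≤
      (1 / 2 + ε) * max (dist (y (s + h)) z) r * (σ * h) :=
    h6.trans (by gcongr; exact h7.trans h1)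
  have h10 := mul_lt_mul_of_pos_right h3 h5'
  have h11 := (abs_le.1 h9).1
  nlinarith

/-- The elementary inequality `v / (1 + v) ≤ 1 - exp (-v)`, scaled by `-N > 0`. -/
lemma le_mul_one_sub_exp (hN : N < 0) {x V : ℝ} (hx : 0 ≤ x) (hV : x ≤ -N * V) :
    x ≤ (1 + V) * (-N * (1 - Real.exp (x / N))) := by
  have hv0 : 0 ≤ x / -N := div_nonneg hx (by linarith)
  have hvV : x / -N ≤ V := by
    rw [div_le_iff₀ (by linarith)]; linarith
  set v := x / -N with hv
  have hxv : x = -N * v := by rw [hv]; field_simp [hN.ne]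
  have e1 : x / N = -v := by rw [hv, div_neg, neg_neg]
  rw [e1, hxv]
  have h1 := Real.add_one_le_exp v
  have h2 : Real.exp (-v) * Real.exp v = 1 := by rw [← Real.exp_add]; simp
  have h3 : (1 + v) * Real.exp (-v) ≤ 1 := by
    rw [← h2, mul_comm]; gcongr; linarith
  have h4 : 0 ≤ 1 - Real.exp (-v) := by
    have := Real.exp_le_one_iff.2 (show -v ≤ 0 by linarith); linarith
  have h5 : v ≤ (1 + V) * (1 - Real.exp (-v)) := by nlinarith
  nlinarith

lemma descSlope_le (hf : LowerSemicontinuous f) (hN : N < 0) (hy : IsEVICurve f K N T y)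
    {s : ℝ} (hs : s ∈ timeInterval T) {σ σ' : ℝ} (hσσ' : σ < σ')
    (hσ : ∃ᶠ h in 𝓝[>] (0 : ℝ), dist (y (s + h)) (y s) ≤ σ * h) :
    descSlope f (y s) ≤ ENNReal.ofReal σ' := by
  -- One `α` serves as the error in the expansion of `𝔰`, as the radius around `y s`, and as the
  -- bound on the energy gap in units of `-N`.
  obtain ⟨α, hα, hα0⟩ : ∃ α : ℝ, (1 + α) * (2 * |K| * α + (1 + 2 * α) * σ) < σ' ∧ 0 < α := by
    have hc : Continuous fun α : ℝ => (1 + α) * (2 * |K| * α + (1 + 2 * α) * σ) := by fun_prop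
    have h0 := (hc.tendsto 0).eventually (eventually_lt_nhds (b := σ') (by simpa using hσσ'))
    exact ((h0.filter_mono nhdsWithin_le_nhds).and (self_mem_nhdsWithin (s := Ioi (0 : ℝ)))).exists
  obtain ⟨ρ, hρ, hρK, hρ1, hρ2⟩ := exists_genSin_sq_near K hN hα0
  -- Lower semicontinuity bounds the energy gap, so that the exponential can be linearised; it also
  -- excludes `f z = -∞`.
  have hlsc : ∀ᶠ z in 𝓝 (y s), ((energy f y s - -N * α : ℝ) : EReal) < f z := by
    refine hf (y s) _ ?_
    change _ < f (y s)
    rw [hy.coe_energy hs]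
    exact EReal.coe_lt_coe_iff.2 (by nlinarith)
  refine limsup_le_of_le (by isBoundedDefault) ?_
  filter_upwards [nhdsWithin_le_nhds hlsc,
    nhdsWithin_le_nhds (Metric.ball_mem_nhds (y s) (lt_min hρ hα0)), self_mem_nhdsWithin]
    with z hz1 hz2 hz3
  rcases le_or_gt (f (y s)) (f z) with hle | hgt
  · have : (f (y s) - f z).toENNReal = 0 := by
      refine EReal.toENNReal_of_nonpos ?_
      exact EReal.sub_nonpos.2 hle
    rw [this, ENNReal.zero_div]
    exact zero_le
  · obtain ⟨e, he⟩ : ∃ e : ℝ, f z = e :=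
      ⟨(f z).toReal, (EReal.coe_toReal (hgt.trans_le le_top).ne (bot_le.trans_lt hz1).ne').symm⟩
    rw [he, hy.coe_energy hs] at hgt
    rw [he] at hz1
    have hz1' := EReal.coe_lt_coe_iff.1 hz1
    have hgt' := EReal.coe_lt_coe_iff.1 hgt
    rw [he, hy.coe_energy hs, ← EReal.coe_sub, EReal.toENNReal_of_ne_top (EReal.coe_ne_top _),
      EReal.toReal_coe]
    have hd : dist (y s) z < min ρ α := by rw [dist_comm]; exact hz2
    have hd0 : 0 < dist (y s) z := dist_pos.2 (Ne.symm hz3)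
    rw [edist_dist, dist_comm z, ← ENNReal.ofReal_div_of_pos hd0]
    refine ENNReal.ofReal_le_ofReal ?_
    rw [div_le_iff₀ hd0]
    have h1 := hy.one_sub_exp_le hα0 hρK (fun r h h' => (hρ1 r h h').2) hρ2 hs hσ he
      (hd.trans_le (min_le_left _ _))
    have h2 := le_mul_one_sub_exp hN (x := energy f y s - e) (V := α) (by linarith) (by linarith)
    have hdα := hd.trans_le (min_le_right _ _)
    set r := dist (y s) z
    calc energy f y s - e ≤ (1 + α) * (-N * (1 - Real.exp ((energy f y s - e) / N))) := h2
      _ = (1 + α) * (2 * (-N / 2 * (1 - Real.exp ((energy f y s - e) / N)))) := by ring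
      _ ≤ (1 + α) * (2 * (|K| * r ^ 2 + (1 / 2 + α) * r * σ)) := by gcongr
      _ = (1 + α) * (2 * |K| * r + (1 + 2 * α) * σ) * r := by ring
      _ ≤ (1 + α) * (2 * |K| * α + (1 + 2 * α) * σ) * r := by gcongr
      _ ≤ σ' * r := by gcongr

/-- A cruder companion of `descSlope_le` between points of the curve, with constants uniform on `[a,
b]`: the total drop `V` (in units of `-N`) replaces the small gap `α`. -/
lemma exists_energy_sub_le (hf : LowerSemicontinuous f) (hN : N < 0) (hy : IsEVICurve f K N T y)
    {a b : ℝ} (hab : Icc a b ⊆ timeInterval T) :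
    ∃ C > 0, ∃ δ > 0, ∀ s ∈ Icc a b, ∀ σ : ℝ, 0 ≤ σ →
      (∃ᶠ h in 𝓝[>] (0 : ℝ), dist (y (s + h)) (y s) ≤ σ * h) →
      ∀ t ∈ Icc a b, s ≤ t → t - s ≤ δ →
        energy f y s - energy f y t ≤ C * (σ + 1) * dist (y s) (y t) := by
  obtain ⟨ρ, hρ, hρK, hρ1, hρ2⟩ := exists_genSin_sq_near K hN (show (0 : ℝ) < 1 / 2 by norm_num)
  obtain ⟨δ, hδ, hball⟩ := hy.exists_forall_dist_lt hab hρ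
  have hanti := hy.energy_antitoneOn hf hN
  rcases lt_or_ge b a with hba | hle
  · exact ⟨1, one_pos, 1, one_pos, fun s hs => absurd (hs.1.trans hs.2) (not_le.2 hba)⟩
  have haT := hab (left_mem_Icc.2 hle)
  have hbT := hab (right_mem_Icc.2 hle)
  set V := (energy f y a - energy f y b) / -N with hV
  have hV0 : 0 ≤ V := div_nonneg (by linarith [hanti haT hbT hle]) (by linarith)
  refine ⟨(1 + V) * (2 * (|K| * ρ + 1)), by positivity, δ / 2, by positivity, ?_⟩
  intro s hs σ hσ0 hσ t ht hst hδ'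
  have hd : dist (y s) (y t) < ρ :=
    hball s hs t ht (by rw [abs_sub_comm, abs_of_nonneg (by linarith)]; linarith)
  have h1 := hy.one_sub_exp_le (by norm_num) hρK (fun r h h' => (hρ1 r h h').2) hρ2 (hab hs)
    hσ (hy.coe_energy (hab ht)) hd
  have hNV : -N * V = energy f y a - energy f y b := by rw [hV]; field_simp [hN.ne]
  have h2 := le_mul_one_sub_exp hN (x := energy f y s - energy f y t) (V := V)
    (by linarith [hanti (hab hs) (hab ht) hst])
    (by linarith [hanti haT (hab hs) hs.1, hanti (hab ht) hbT ht.2])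
  set r := dist (y s) (y t) with hr
  have hr0 : 0 ≤ r := dist_nonneg
  have h3 : |K| * r ^ 2 + (1 / 2 + 1 / 2) * r * σ ≤ (|K| * ρ + 1) * (σ + 1) * r := by
    have : |K| * r ≤ |K| * ρ := by gcongr
    have h4 : |K| * r * r ≤ |K| * ρ * r := by gcongr
    have h5 : 0 ≤ |K| * ρ * σ * r := by positivity
    nlinarith
  calc energy f y s - energy f y t
      ≤ (1 + V) * (-N * (1 - Real.exp ((energy f y s - energy f y t) / N))) := h2
    _ = (1 + V) * (2 * (-N / 2 * (1 - Real.exp ((energy f y s - energy f y t) / N)))) := by ring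
    _ ≤ (1 + V) * (2 * ((|K| * ρ + 1) * (σ + 1) * r)) := by
        gcongr (1 + V) * (2 * ?_)
        exact h1.trans h3
    _ = _ := by ring

lemma eventually_energy_sub_le (hy : IsEVICurve f K N T y)
    {t : ℝ} (ht : t ∈ timeInterval T) {D : ℝ}
    (hD : descSlope f (y t) < ENNReal.ofReal D) :
    ∀ᶠ h in 𝓝[>] (0 : ℝ), energy f y t - energy f y (t + h) ≤ D * dist (y (t + h)) (y t) := by
  have h1 := eventually_nhdsWithin_iff.1 (eventually_lt_of_limsup_lt hD)
  have h2 := (tendsto_nhdsWithin_iff.1 (tendsto_add_nhdsGT_zero t)).1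
  filter_upwards [h2.eventually ((hy.continuousAt ht).eventually h1),
    h2.eventually ((isOpen_timeInterval T).mem_nhds ht)] with h hh hT
  -- The slope is a limit over the punctured neighbourhood, so a return to `y t` is treated
  -- separately.
  by_cases heq : y (t + h) = y t
  · simp [energy, heq]
  · have h3 := hh heq
    have hd0 : 0 < dist (y (t + h)) (y t) := dist_pos.2 heq
    rw [hy.coe_energy hT, hy.coe_energy ht, ← EReal.coe_sub,
      EReal.toENNReal_of_ne_top (EReal.coe_ne_top _), EReal.toReal_coe, edist_dist,
      ← ENNReal.ofReal_div_of_pos hd0] at h3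
    have h4 := (ENNReal.ofReal_lt_ofReal_iff'.1 h3).1
    rw [div_lt_iff₀ hd0] at h4
    exact h4.le

end IsEVICurve

/-! ### Absolute continuity of the curve. -/

lemma absolutelyContinuousOnInterval_of_dist_le {Y Z : Type*} [PseudoMetricSpace Y]
    [PseudoMetricSpace Z] {u : ℝ → Y} {v : ℝ → Z} {a b C : ℝ}
    (hv : AbsolutelyContinuousOnInterval v a b)
    (h : ∀ s ∈ uIcc a b, ∀ t ∈ uIcc a b, dist (u s) (u t) ≤ C * dist (v s) (v t)) :
    AbsolutelyContinuousOnInterval u a b := by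
  have hv' := Tendsto.const_mul C hv
  rw [mul_zero] at hv'
  refine squeeze_zero' (Eventually.of_forall fun E => Finset.sum_nonneg fun _ _ => dist_nonneg)
    ?_ hv'
  have : ∀ᶠ E in AbsolutelyContinuousOnInterval.totalLengthFilter ⊓
      𝓟 (AbsolutelyContinuousOnInterval.disjWithin a b),
      E ∈ AbsolutelyContinuousOnInterval.disjWithin a b := eventually_inf_principal.2 (by simp)
  filter_upwards [this] with E hE
  rw [Finset.mul_sum]
  exact Finset.sum_le_sum fun i hi => h _ (hE.1 i hi).1 _ (hE.1 i hi).2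

/-- A monotone function sends disjoint intervals to disjoint intervals of values; compare their
total length with that of `(E b, E a]`. -/
lemma sum_dist_le_of_antitoneOn {E : ℝ → ℝ} {a b : ℝ} (hab : a ≤ b)
    (hE : AntitoneOn E (Icc a b)) {I : ℕ × (ℕ → ℝ × ℝ)}
    (hI : I ∈ AbsolutelyContinuousOnInterval.disjWithin a b) :
    ∑ i ∈ Finset.range I.1, dist (E (I.2 i).1) (E (I.2 i).2) ≤ E a - E b := by
  have ha : a ∈ Icc a b := left_mem_Icc.2 hab
  have hb : b ∈ Icc a b := right_mem_Icc.2 hab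
  obtain ⟨h1, h2⟩ := hI
  rw [uIcc_of_le hab] at h1
  have hio : ∀ u ∈ Icc a b, ∀ v ∈ Icc a b,
      uIoc (E u) (E v) = Ioc (E (max u v)) (E (min u v)) := by
    intro u hu v hv
    rcases le_total u v with h | h
    · rw [max_eq_right h, min_eq_left h, uIoc_of_ge (hE hu hv h)]
    · rw [max_eq_left h, min_eq_right h, uIoc_of_le (hE hv hu h)]
  have hmax : ∀ u ∈ Icc a b, ∀ v ∈ Icc a b, max u v ∈ Icc a b := fun u hu v hv =>
    ⟨hu.1.trans (le_max_left _ _), max_le hu.2 hv.2⟩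
  have hmin : ∀ u ∈ Icc a b, ∀ v ∈ Icc a b, min u v ∈ Icc a b := fun u hu v hv =>
    ⟨le_min hu.1 hv.1, (min_le_left _ _).trans hu.2⟩
  have hdisj : (Finset.range I.1 : Set ℕ).PairwiseDisjoint
      (fun i => uIoc (E (I.2 i).1) (E (I.2 i).2)) := by
    intro i hi j hj hij
    obtain ⟨hi1, hi2⟩ := h1 i hi
    obtain ⟨hj1, hj2⟩ := h1 j hj
    have h3 := h2 hi hj hij
    simp only [Function.onFun, uIoc, Ioc_disjoint_Ioc] at h3
    simp only [Function.onFun]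
    rw [hio _ hi1 _ hi2, hio _ hj1 _ hj2, Ioc_disjoint_Ioc]
    have mi := hmin _ hi1 _ hi2
    have mj := hmin _ hj1 _ hj2
    have Mi := hmax _ hi1 _ hi2
    have Mj := hmax _ hj1 _ hj2
    rcases min_le_iff.1 h3 with h | h <;> rcases le_max_iff.1 h with h | h
    · exact (min_le_left _ _).trans ((hE Mi mi h).trans (le_max_left _ _))
    · exact (min_le_right _ _).trans ((hE Mi mj h).trans (le_max_left _ _))
    · exact (min_le_left _ _).trans ((hE Mj mi h).trans (le_max_right _ _))
    · exact (min_le_right _ _).trans ((hE Mj mj h).trans (le_max_right _ _))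
  have hsub : (⋃ i ∈ Finset.range I.1, uIoc (E (I.2 i).1) (E (I.2 i).2)) ⊆ Ioc (E b) (E a) := by
    simp only [iUnion_subset_iff]
    intro i hi
    obtain ⟨hi1, hi2⟩ := h1 i hi
    rw [hio _ hi1 _ hi2]
    exact Ioc_subset_Ioc (hE (hmax _ hi1 _ hi2) hb (hmax _ hi1 _ hi2).2)
      (hE ha (hmin _ hi1 _ hi2) (hmin _ hi1 _ hi2).1)
  have hvol := measure_mono (μ := volume) hsub
  rw [measure_biUnion_finset hdisj (fun i _ => measurableSet_uIoc)] at hvol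
  have hterm : ∀ i ∈ Finset.range I.1, volume (uIoc (E (I.2 i).1) (E (I.2 i).2)) =
      ENNReal.ofReal (dist (E (I.2 i).1) (E (I.2 i).2)) := by
    intro i _
    rw [uIoc, Real.volume_Ioc, max_sub_min_eq_abs', Real.dist_eq]
  rw [Finset.sum_congr rfl hterm, ← ENNReal.ofReal_sum_of_nonneg (fun _ _ => dist_nonneg),
    Real.volume_Ioc, ENNReal.ofReal_le_ofReal_iff (sub_nonneg.2 (hE ha hb hab))] at hvol
  exact hvol

/-- By the inequality of the means, `d ≤ η * ΔE + C / (4 * η) * Δt`. The energy terms sum to at most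
`η` times the total drop, however singular `E` is, and the time terms are small with the total
length. -/
lemma absolutelyContinuousOnInterval_of_dist_sq_le {y : ℝ → X} {E : ℝ → ℝ} {a b C δ : ℝ}
    (hab : a ≤ b) (hE : AntitoneOn E (Icc a b)) (hC : 0 < C) (hδ : 0 < δ)
    (h : ∀ s ∈ Icc a b, ∀ t ∈ Icc a b, s ≤ t → t - s ≤ δ →
      dist (y s) (y t) ^ 2 ≤ C * (t - s) * (E s - E t)) :
    AbsolutelyContinuousOnInterval y a b := by
  have h' : ∀ s ∈ Icc a b, ∀ t ∈ Icc a b, dist s t ≤ δ →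
      dist (y s) (y t) ^ 2 ≤ C * dist s t * dist (E s) (E t) := by
    intro s hs t ht hst
    rw [Real.dist_eq] at hst ⊢
    rcases le_total s t with hle | hle
    · rw [abs_sub_comm, abs_of_nonneg (sub_nonneg.2 hle)] at hst ⊢
      rw [Real.dist_eq, abs_of_nonneg (sub_nonneg.2 (hE hs ht hle))]
      exact h s hs t ht hle hst
    · rw [abs_of_nonneg (sub_nonneg.2 hle)] at hst ⊢
      rw [dist_comm, dist_comm (E s), Real.dist_eq,
        abs_of_nonneg (sub_nonneg.2 (hE ht hs hle))]
      exact h t ht s hs hle hst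
  rw [absolutelyContinuousOnInterval_iff]
  intro ε hε
  have hV : 0 ≤ E a - E b := sub_nonneg.2 (hE (left_mem_Icc.2 hab) (right_mem_Icc.2 hab) hab)
  set η := ε / (2 * (E a - E b + 1)) with hη
  have hη0 : 0 < η := by positivity
  refine ⟨min δ (2 * ε * η / C), by positivity, fun I hI hlen => ?_⟩
  have hsum := sum_dist_le_of_antitoneOn hab hE hI
  have hI1 := hI.1
  rw [uIcc_of_le hab] at hI1
  have hterm : ∀ i ∈ Finset.range I.1, dist (y (I.2 i).1) (y (I.2 i).2) ≤
      η * dist (E (I.2 i).1) (E (I.2 i).2) + C / (4 * η) * dist (I.2 i).1 (I.2 i).2 := by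
    intro i hi
    have h1 : dist (I.2 i).1 (I.2 i).2 ≤ δ :=
      (Finset.single_le_sum (f := fun i => dist (I.2 i).1 (I.2 i).2)
        (fun _ _ => dist_nonneg) hi).trans (hlen.le.trans (min_le_left _ _))
    have h2 := h' _ (hI1 i hi).1 _ (hI1 i hi).2 h1
    refine le_of_sq_le_sq ?_ (by positivity)
    have h3 : C * dist (I.2 i).1 (I.2 i).2 * dist (E (I.2 i).1) (E (I.2 i).2) =
      4 * (η * dist (E (I.2 i).1) (E (I.2 i).2)) * (C / (4 * η) * dist (I.2 i).1 (I.2 i).2) := by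
      field_simp
    rw [h3] at h2
    nlinarith [sq_nonneg (η * dist (E (I.2 i).1) (E (I.2 i).2) -
      C / (4 * η) * dist (I.2 i).1 (I.2 i).2)]
  refine (Finset.sum_le_sum hterm).trans_lt ?_
  rw [Finset.sum_add_distrib, ← Finset.mul_sum, ← Finset.mul_sum]
  have h4 : η * ∑ i ∈ Finset.range I.1, dist (E (I.2 i).1) (E (I.2 i).2) ≤ ε / 2 := by
    calc _ ≤ η * (E a - E b) := by gcongr
      _ ≤ η * (E a - E b + 1) := by gcongr; linarith
      _ = ε / 2 := by rw [hη]; field_simp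
  have h5 : C / (4 * η) * ∑ i ∈ Finset.range I.1, dist (I.2 i).1 (I.2 i).2 < ε / 2 := by
    calc _ < C / (4 * η) * (2 * ε * η / C) := by
          gcongr
          exact hlen.trans_le (min_le_right _ _)
      _ = ε / 2 := by field_simp; ring
  linarith

/-! ### The metric derivative. -/

/-- Existence of the metric derivative of an absolutely continuous curve. -/
theorem exists_metric_derivative {y : ℝ → X} {a b : ℝ} (hab : a < b)
    (hyc : ContinuousOn y (Icc a b)) (hy : AbsolutelyContinuousOnInterval y a b)
    {V : ℝ → ℝ} (hV : MonotoneOn V (Icc a b))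
    (h : ∀ s ∈ Icc a b, ∀ t ∈ Icc a b, s ≤ t → dist (y s) (y t) ≤ V t - V s) :
    ∃ m : ℝ → ℝ, (∀ t, 0 ≤ m t) ∧ IntervalIntegrable m volume a b ∧
      (∀ s ∈ Icc a b, ∀ t ∈ Icc a b, s ≤ t → dist (y s) (y t) ≤ ∫ r in s..t, m r) ∧
      ∀ᵐ t, t ∈ Ioo a b → Tendsto (fun s => dist (y s) (y t) / |s - t|) (𝓝[≠] t) (𝓝 (m t)) := by
  -- The metric derivative is recovered as the supremum of the `|φ_q'|` over the countable family of
  -- distances to the points `y q`.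
  set φ : ℚ → ℝ → ℝ := fun q t => dist (y t) (y q) with hφ
  have hφd : ∀ q s t, |φ q s - φ q t| ≤ dist (y s) (y t) := fun q s t => abs_dist_sub_le _ _ _
  have hφac : ∀ q, AbsolutelyContinuousOnInterval (φ q) a b := fun q =>
    absolutelyContinuousOnInterval_of_dist_le (C := 1) hy fun s _ t _ => by
      rw [one_mul, Real.dist_eq]; exact hφd q s t
  have hφdiff : ∀ᵐ t, ∀ q, t ∈ uIcc a b → DifferentiableAt ℝ (φ q) t :=
    ae_all_iff.2 fun q => (hφac q).ae_differentiableAt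
  rw [uIcc_of_le hab.le] at hφdiff
  set M : ℝ → ℝ≥0∞ := fun t => ⨆ q, ‖deriv (φ q) t‖ₑ with hM
  have hMmeas : Measurable M := Measurable.iSup fun q => (measurable_deriv (φ q)).enorm
  -- The monotone majorant `V` makes the supremum finite almost everywhere and integrable.
  have hle : ∀ᵐ t, t ∈ Ioo a b → M t ≤ ENNReal.ofReal (deriv V t) := by
    filter_upwards [hφdiff, hV.ae_differentiableWithinAt_of_mem] with t ht hVt htI
    have htI' := Ioo_subset_Icc_self htI
    have hn : Icc a b ∈ 𝓝 t := Icc_mem_nhds htI.1 htI.2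
    have hV1 := ((hVt htI').differentiableAt hn).hasDerivAt
    have hV2 := hasDerivAt_iff_tendsto_slope.1 hV1
    refine iSup_le fun q => ?_
    have hq := hasDerivAt_iff_tendsto_slope.1 (ht q htI').hasDerivAt
    rw [Real.enorm_eq_ofReal_abs]
    refine ENNReal.ofReal_le_ofReal (le_of_tendsto_of_tendsto hq.abs hV2 ?_)
    filter_upwards [nhdsWithin_le_nhds hn, self_mem_nhdsWithin] with s hs hst
    rw [slope_def_field, slope_def_field, abs_div]
    rcases lt_or_gt_of_ne (show s ≠ t from hst) with hlt | hlt
    · have h1 := h s hs t htI' hlt.le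
      rw [abs_of_neg (sub_neg.2 hlt), div_neg, ← neg_div]
      exact div_le_div_of_nonpos_of_le (sub_neg.2 hlt).le (by linarith [hφd q s t])
    · have h1 := h t htI' s hs hlt.le
      rw [abs_of_pos (sub_pos.2 hlt)]
      have := sub_pos.2 hlt
      gcongr
      exact (hφd q s t).trans (by rwa [dist_comm])
  have hae : ∀ᵐ t ∂(volume.restrict (Ioc a b)), M t ≤ ENNReal.ofReal (deriv V t) := by
    rw [← restrict_Ioo_eq_restrict_Ioc]
    exact (ae_restrict_iff' measurableSet_Ioo).2 hle
  have hVint := (show MonotoneOn V (uIcc a b) by rwa [uIcc_of_le hab.le]).intervalIntegrable_deriv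
  have hmint : IntervalIntegrable (fun t => (M t).toReal) volume a b := by
    rw [intervalIntegrable_iff_integrableOn_Ioc_of_le hab.le] at hVint ⊢
    refine hVint.norm.mono' hMmeas.ennreal_toReal.aestronglyMeasurable ?_
    filter_upwards [hae] with t ht
    rw [Real.norm_of_nonneg ENNReal.toReal_nonneg]
    refine (ENNReal.toReal_mono ENNReal.ofReal_ne_top ht).trans ?_
    rw [ENNReal.toReal_ofReal']
    exact max_le (le_abs_self _) (abs_nonneg _)
  have hderiv_le : ∀ q, ∀ᵐ t ∂(volume.restrict (Ioc a b)), deriv (φ q) t ≤ (M t).toReal := by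
    intro q
    filter_upwards [hae] with t ht
    have h1 : ‖deriv (φ q) t‖ₑ ≤ M t := le_iSup (fun q => ‖deriv (φ q) t‖ₑ) q
    have h2 := ENNReal.toReal_mono (ne_top_of_le_ne_top ENNReal.ofReal_ne_top ht) h1
    rw [toReal_enorm] at h2
    exact (le_abs_self _).trans h2
  have hdist : ∀ s ∈ Icc a b, ∀ t ∈ Icc a b, s ≤ t →
      dist (y s) (y t) ≤ ∫ r in s..t, (M r).toReal := by
    intro s hs t ht hst
    rcases hst.eq_or_lt with rfl | hlt
    · simp
    have hsub : uIcc s t ⊆ uIcc a b := by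
      rw [uIcc_of_le hst, uIcc_of_le hab.le]; exact Icc_subset_Icc hs.1 ht.2
    refine le_of_forall_pos_le_add fun ε hε => ?_
    obtain ⟨δ, hδ, hball⟩ := Metric.continuousWithinAt_iff.1 (hyc s hs) (ε / 2) (by positivity)
    -- With `y q` close to `y s`, `d(y s, y t) ≤ 2 * φ q s + (φ q t - φ q s)`, and the last
    -- increment is the integral of a derivative bounded by `M`.
    obtain ⟨q, hq1, hq2⟩ := exists_rat_btwn (show s < min t (s + δ) from lt_min hlt (by linarith))
    have hq3 := hball (x := (q : ℝ))
      ⟨hs.1.trans hq1.le, hq2.le.trans ((min_le_left _ _).trans ht.2)⟩ (by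
        rw [Real.dist_eq, abs_of_pos (sub_pos.2 hq1)]
        linarith [hq2.trans_le (min_le_right _ _)])
    have hac := (hφac q).mono hsub
    have hint := hac.integral_deriv_eq_sub
    have hmono : ∫ r in s..t, deriv (φ q) r ≤ ∫ r in s..t, (M r).toReal := by
      refine intervalIntegral.integral_mono_ae_restrict hst hac.intervalIntegrable_deriv
        (hmint.mono_set hsub) ?_
      rw [← restrict_Ioc_eq_restrict_Icc]
      exact ae_mono (Measure.restrict_mono (Ioc_subset_Ioc hs.1 ht.2) le_rfl) (hderiv_le q)
    have h1 : dist (y s) (y t) ≤ φ q s + φ q t := dist_triangle_right _ _ _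
    have h2 : φ q s < ε / 2 := by rw [hφ]; simpa [dist_comm] using hq3
    linarith
  refine ⟨fun t => (M t).toReal, fun _ => ENNReal.toReal_nonneg, hmint, hdist, ?_⟩
  filter_upwards [hφdiff, hle, hmint.ae_hasDerivAt_integral] with t ht htM htF htI
  have htI' := Ioo_subset_Icc_self htI
  have hn : Icc a b ∈ 𝓝 t := Icc_mem_nhds htI.1 htI.2
  have hMtop : M t ≠ ⊤ := ne_top_of_le_ne_top ENNReal.ofReal_ne_top (htM htI)
  rw [tendsto_order]
  constructor
  -- Below, a single `φ q` with large derivative suffices; above, Lebesgue differentiation of the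
  -- integral of `M`.
  · intro c hc
    rcases lt_or_ge c 0 with hc0 | hc0
    · exact Eventually.of_forall fun s => hc0.trans_le (by positivity)
    have h1 : ENNReal.ofReal c < M t := (ENNReal.ofReal_lt_iff_lt_toReal hc0 hMtop).2 hc
    obtain ⟨q, hq⟩ := lt_iSup_iff.1 h1
    rw [Real.enorm_eq_ofReal_abs, ENNReal.ofReal_lt_ofReal_iff_of_nonneg hc0] at hq
    have h2 := (hasDerivAt_iff_tendsto_slope.1 (ht q htI').hasDerivAt).abs
    filter_upwards [h2.eventually (eventually_gt_nhds hq)] with s hs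
    refine hs.trans_le ?_
    rw [slope_def_field, abs_div]
    gcongr
    exact hφd q s t
  · intro c hc
    have h1 := hasDerivAt_iff_tendsto_slope.1
      (htF (by rwa [uIcc_of_le hab.le]) a left_mem_uIcc)
    have h2 := h1.abs
    rw [abs_of_nonneg ENNReal.toReal_nonneg] at h2
    filter_upwards [h2.eventually (eventually_lt_nhds hc), nhdsWithin_le_nhds hn] with s hs hsI
    refine lt_of_le_of_lt ?_ hs
    rw [slope_def_field, abs_div]
    gcongr
    have hI : ∀ u ∈ Icc a b, IntervalIntegrable (fun t => (M t).toReal) volume a u := fun u hu =>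
      hmint.mono_set (by
        rw [uIcc_of_le hab.le, uIcc_of_le hu.1]; exact Icc_subset_Icc_right hu.2)
    rw [intervalIntegral.integral_interval_sub_left (hI s hsI) (hI t htI')]
    rcases le_total s t with hst | hst
    · rw [intervalIntegral.integral_symm, abs_neg]
      exact (hdist s hsI t htI' hst).trans (le_abs_self _)
    · rw [dist_comm]
      exact (hdist t htI' s hsI hst).trans (le_abs_self _)

/-! ### Excluding a singular part of the energy. -/

lemma sq_intervalIntegral_le {M : ℝ → ℝ} {a b : ℝ} (hab : a < b)
    (hM : IntervalIntegrable M volume a b)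
    (hM2 : IntervalIntegrable (fun x => M x ^ 2) volume a b) :
    (∫ x in a..b, M x) ^ 2 ≤ (b - a) * ∫ x in a..b, M x ^ 2 := by
  set A := ∫ x in a..b, M x with hA
  have hba : 0 < b - a := sub_pos.2 hab
  have h0 : 0 ≤ ∫ x in a..b, (M x - A / (b - a)) ^ 2 :=
    intervalIntegral.integral_nonneg hab.le fun _ _ => sq_nonneg _
  have h1 : ∫ x in a..b, (M x - A / (b - a)) ^ 2 =
      (∫ x in a..b, M x ^ 2) - 2 * (A / (b - a)) * A + (A / (b - a)) ^ 2 * (b - a) := by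
    have e : (fun x => (M x - A / (b - a)) ^ 2) =
        fun x => M x ^ 2 - 2 * (A / (b - a)) * M x + (A / (b - a)) ^ 2 := by
      funext x; ring
    rw [e, intervalIntegral.integral_add (hM2.sub (hM.const_mul _)) intervalIntegrable_const,
      intervalIntegral.integral_sub hM2 (hM.const_mul _), intervalIntegral.integral_const_mul,
      intervalIntegral.integral_const]
    simp [hA, mul_comm]
  have h2 : 2 * (A / (b - a)) * A - (A / (b - a)) ^ 2 * (b - a) = A ^ 2 / (b - a) := by
    field_simp; ring
  have h3 : A ^ 2 / (b - a) ≤ ∫ x in a..b, M x ^ 2 := by linarith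
  rw [div_le_iff₀ hba] at h3
  linarith

/-- Averaging over starting times `r` in `[s - h, s]` turns an almost-everywhere estimate into one
at every `s`: `h * (E s - E (s + h)) ≤ A²`, and Cauchy–Schwarz on an interval of length `2 * h`
cancels the `h`. -/
lemma sub_le_two_mul_integral_sq {E M : ℝ → ℝ} {s h : ℝ} (hh : 0 < h)
    (hE : AntitoneOn E (Icc (s - h) (s + h))) (hM0 : ∀ x, 0 ≤ M x)
    (hM : IntervalIntegrable M volume (s - h) (s + h))
    (hM2 : IntervalIntegrable (fun x => M x ^ 2) volume (s - h) (s + h))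
    (hae : ∀ᵐ r, r ∈ Icc (s - h) s → E r - E (s + h) ≤ M r * ∫ x in r..s + h, M x) :
    E s - E (s + h) ≤ 2 * ∫ x in (s - h)..(s + h), M x ^ 2 := by
  set A := ∫ x in (s - h)..(s + h), M x with hA
  have hsub : uIcc (s - h) s ⊆ uIcc (s - h) (s + h) := by
    rw [uIcc_of_le (by linarith), uIcc_of_le (by linarith)]
    exact Icc_subset_Icc_right (by linarith)
  have hA0 : 0 ≤ A := intervalIntegral.integral_nonneg (by linarith) fun x _ => hM0 x
  have h1 : ∫ _ in (s - h)..s, (E s - E (s + h)) ≤ ∫ r in (s - h)..s, M r * A := by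
    refine intervalIntegral.integral_mono_ae_restrict (by linarith) intervalIntegrable_const
      ((hM.mono_set hsub).mul_const A) ((ae_restrict_iff' measurableSet_Icc).2 ?_)
    filter_upwards [hae] with r hr hrI
    have h2 : E s ≤ E r := hE ⟨hrI.1, by linarith [hrI.2]⟩ ⟨by linarith, by linarith⟩ hrI.2
    have h3 : ∫ x in r..s + h, M x ≤ A :=
      intervalIntegral.integral_mono_interval hrI.1 (by linarith [hrI.2]) le_rfl
        (Eventually.of_forall hM0) hM
    calc E s - E (s + h) ≤ E r - E (s + h) := by linarith
      _ ≤ _ := hr hrI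
      _ ≤ M r * A := mul_le_mul_of_nonneg_left h3 (hM0 r)
  rw [intervalIntegral.integral_const, intervalIntegral.integral_mul_const, smul_eq_mul] at h1
  have h4 : ∫ x in (s - h)..s, M x ≤ A :=
    intervalIntegral.integral_mono_interval le_rfl (by linarith) (by linarith)
      (Eventually.of_forall hM0) hM
  have h5 := sq_intervalIntegral_le (by linarith) hM hM2
  have h6 : (∫ x in (s - h)..s, M x) * A ≤ A ^ 2 := by nlinarith
  have h7 : h * (E s - E (s + h)) ≤ h * (2 * ∫ x in (s - h)..(s + h), M x ^ 2) := by
    nlinarith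
  exact le_of_mul_le_mul_left h7 hh

/-- A monotone function that satisfies a one-sided estimate of slope type almost everywhere has
no singular part. -/
theorem absolutelyContinuousOnInterval_of_slope_bound {E M : ℝ → ℝ} {a' a b δ : ℝ} (ha' : a' < a)
    (hab : a ≤ b) (hE : AntitoneOn E (Icc a' b)) (hM0 : ∀ x, 0 ≤ M x)
    (hM : IntervalIntegrable M volume a' b)
    (hM2 : IntervalIntegrable (fun x => M x ^ 2) volume a' b) (hδ : 0 < δ)
    (hae : ∀ᵐ r, r ∈ Icc a' b → ∀ t ∈ Icc a' b, r ≤ t → t - r ≤ δ →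
      E r - E t ≤ M r * ∫ x in r..t, M x) :
    AbsolutelyContinuousOnInterval E a b := by
  have ha'b : a' ≤ b := ha'.le.trans hab
  set P : ℝ → ℝ := fun x => ∫ r in a'..x, M r ^ 2 with hP
  have hPac : AbsolutelyContinuousOnInterval P a' b :=
    hM2.absolutelyContinuousOnInterval_intervalIntegral left_mem_uIcc
  have hPc : ContinuousOn P (Icc a' b) := by
    have := hPac.continuousOn
    rwa [uIcc_of_le ha'b] at this
  have hint : ∀ {g : ℝ → ℝ}, IntervalIntegrable g volume a' b → ∀ u ∈ Icc a' b, ∀ v ∈ Icc a' b,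
      IntervalIntegrable g volume u v := fun hg u hu v hv =>
    hg.mono_set (by rw [uIcc_of_le ha'b]; exact uIcc_subset_Icc hu hv)
  have ha'mem : a' ∈ Icc a' b := left_mem_Icc.2 ha'b
  have hPsub : ∀ u ∈ Icc a' b, ∀ v ∈ Icc a' b, ∫ r in u..v, M r ^ 2 = P v - P u := fun u hu v hv =>
    (intervalIntegral.integral_interval_sub_left (hint hM2 _ ha'mem _ hv)
      (hint hM2 _ ha'mem _ hu)).symm
  have hPmono : MonotoneOn P (Icc a' b) := by
    intro u hu v hv huv
    have : 0 ≤ ∫ r in u..v, M r ^ 2 :=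
      intervalIntegral.integral_nonneg huv fun _ _ => sq_nonneg _
    rw [hPsub u hu v hv] at this
    linarith
  have hstep : ∀ s h, 0 < h → a' ≤ s - h → s + h ≤ b → 2 * h ≤ δ →
      E s - E (s + h) ≤ 2 * (P (s + h) - P (s - h)) := by
    intro s h hh h1 h2 h3
    have hu : s - h ∈ Icc a' b := ⟨h1, by linarith⟩
    have hv : s + h ∈ Icc a' b := ⟨by linarith, h2⟩
    rw [← hPsub _ hu _ hv]
    refine sub_le_two_mul_integral_sq hh (hE.mono (Icc_subset_Icc h1 h2)) hM0 (hint hM _ hu _ hv)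
      (hint hM2 _ hu _ hv) ?_
    filter_upwards [hae] with r hr hrI
    exact hr ⟨h1.trans hrI.1, by linarith [hrI.2]⟩ _ hv (by linarith [hrI.2])
      (by linarith [hrI.1])
  -- Cut `[s, t]` into `k + 1` equal pieces and sum `hstep`. The windows of width `2 * h` overlap
  -- twice, which doubles the constant; the overhang to the left of `s`, for which the margin `a' <
  -- a` leaves room, vanishes as `k → ∞`.
  have hbound : ∀ s ∈ Icc a b, ∀ t ∈ Icc a b, s ≤ t → E s - E t ≤ 4 * (P t - P s) := by
    intro s hs t ht hst
    rcases hst.eq_or_lt with rfl | hlt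
    · simp
    have hs' : s ∈ Icc a' b := ⟨ha'.le.trans hs.1, hs.2⟩
    have ht' : t ∈ Icc a' b := ⟨ha'.le.trans ht.1, ht.2⟩
    have hlim0 : Tendsto (fun k : ℕ => (t - s) / ((k : ℝ) + 1)) atTop (𝓝 0) :=
      tendsto_const_div_atTop_nhds_zero_nat (t - s) |>.comp (tendsto_add_atTop_nat 1)
        |>.congr fun k => by simp
    have hlim1 : Tendsto (fun k : ℕ => s - (t - s) / ((k : ℝ) + 1)) atTop (𝓝 s) := by
      simpa using tendsto_const_nhds.sub hlim0
    have hsI : Icc a' b ∈ 𝓝[≤] s :=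
      Icc_mem_nhdsLE_of_mem ⟨ha'.trans_le hs.1, hs.2⟩
    have hPs : Tendsto P (𝓝[≤] s) (𝓝 (P s)) :=
      (hPc s hs').mono_left (nhdsWithin_le_of_mem hsI)
    have hlim2 : Tendsto (fun k : ℕ => s - (t - s) / ((k : ℝ) + 1)) atTop (𝓝[≤] s) :=
      tendsto_nhdsWithin_iff.2 ⟨hlim1, Eventually.of_forall fun k => by
        have : 0 ≤ (t - s) / ((k : ℝ) + 1) := div_nonneg (by linarith) (by positivity)
        simpa using this⟩
    have hlim3 : Tendsto (fun k : ℕ => 4 * (P t - P (s - (t - s) / ((k : ℝ) + 1)))) atTop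
        (𝓝 (4 * (P t - P s))) :=
      ((hPs.comp hlim2).const_sub _).const_mul _
    refine ge_of_tendsto hlim3 ?_
    filter_upwards [hlim0.eventually (eventually_lt_nhds (show 0 < a - a' by linarith)),
      hlim0.eventually (eventually_lt_nhds (show 0 < δ / 2 by linarith))] with k hk1 hk2
    set h := (t - s) / ((k : ℝ) + 1) with hh
    have hh0 : 0 < h := div_pos (by linarith) (by positivity)
    have hkh : s + ((k + 1 : ℕ) : ℝ) * h = t := by
      rw [hh]; push_cast; field_simp; ring
    have hind : ∀ i : ℕ, i ≤ k + 1 → E s - E (s + i * h) ≤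
        2 * ((P (s + i * h) + P (s + i * h - h)) - (P s + P (s - h))) := by
      intro i
      induction i with
      | zero => intro _; simp
      | succ i ih =>
        intro hi
        have h1 := ih (by omega)
        have hi0 : (0 : ℝ) ≤ i * h := by positivity
        have h2 : s + (((i + 1 : ℕ) : ℝ)) * h ≤ t := by
          rw [← hkh]
          have : (((i + 1 : ℕ) : ℝ)) ≤ ((k + 1 : ℕ) : ℝ) := by exact_mod_cast hi
          gcongr
        have h3 : s + (((i + 1 : ℕ) : ℝ)) * h = s + i * h + h := by push_cast; ring
        rw [h3] at h2 ⊢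
        have h4 := hstep (s + i * h) h hh0 (by linarith [hs.1]) (by linarith [ht.2])
          (by linarith)
        rw [add_sub_cancel_right]
        linarith
    have h5 := hind (k + 1) le_rfl
    rw [hkh] at h5
    have h6 : P (t - h) ≤ P t := by
      have hht : s ≤ t - h := by
        have : ((k + 1 : ℕ) : ℝ) * h = k * h + h := by push_cast; ring
        have h0 : (0 : ℝ) ≤ k * h := by positivity
        linarith
      exact hPmono ⟨hs'.1.trans hht, by linarith [ht.2]⟩ ht' (by linarith)
    have h7 : P (s - h) ≤ P s :=
      hPmono ⟨by linarith [hs.1], by linarith [hs.2]⟩ hs' (by linarith)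
    linarith
  refine absolutelyContinuousOnInterval_of_dist_le (C := 4)
    (hPac.mono (by
      rw [uIcc_of_le hab, uIcc_of_le ha'b]; exact Icc_subset_Icc_left ha'.le)) ?_
  rw [uIcc_of_le hab]
  have hsub : Icc a b ⊆ Icc a' b := Icc_subset_Icc_left ha'.le
  have key : ∀ s ∈ Icc a b, ∀ t ∈ Icc a b, s ≤ t → dist (E s) (E t) ≤ 4 * dist (P s) (P t) := by
    intro s hs t ht hst
    rw [Real.dist_eq, abs_of_nonneg (sub_nonneg.2 (hE (hsub hs) (hsub ht) hst)), dist_comm,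
      Real.dist_eq, abs_of_nonneg (sub_nonneg.2 (hPmono (hsub hs) (hsub ht) hst))]
    exact hbound s hs t ht hst
  intro s hs t ht
  rcases le_total s t with h | h
  · exact key s hs t ht h
  · rw [dist_comm, dist_comm (P s)]
    exact key t ht s hs h

/-! ### Passing from local to global, and integrals up to time `0`. -/

lemma tendsto_metricQuotient {t m : ℝ}
    (h : Tendsto (fun s => dist (y s) (y t) / |s - t|) (𝓝[≠] t) (𝓝 m)) :
    Tendsto (metricQuotient y t) (𝓝[≠] t) (𝓝 (ENNReal.ofReal m)) := by
  refine (ENNReal.tendsto_ofReal h).congr' ?_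
  filter_upwards [self_mem_nhdsWithin] with s hs
  rw [metricQuotient, edist_dist, edist_dist, Real.dist_eq,
    ENNReal.ofReal_div_of_pos (abs_pos.2 (sub_ne_zero.2 hs))]

lemma dist_le_of_forall_dist_le {W : ℝ → ℝ} {a b δ : ℝ} (hδ : 0 < δ)
    (h : ∀ s ∈ Icc a b, ∀ t ∈ Icc a b, s ≤ t → t - s ≤ δ → dist (y s) (y t) ≤ W t - W s) :
    ∀ s ∈ Icc a b, ∀ t ∈ Icc a b, s ≤ t → dist (y s) (y t) ≤ W t - W s := by
  have key : ∀ k : ℕ, ∀ s ∈ Icc a b, ∀ t ∈ Icc a b, s ≤ t → t - s ≤ k * δ →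
      dist (y s) (y t) ≤ W t - W s := by
    intro k
    induction k with
    | zero =>
      intro s hs t ht hst hk
      exact h s hs t ht hst (by simp at hk; linarith)
    | succ k ih =>
      intro s hs t ht hst hk
      push_cast at hk
      rcases le_total (t - s) δ with hle | hle
      · exact h s hs t ht hst hle
      · have hm : t - δ ∈ Icc a b := ⟨by linarith [hs.1], by linarith [ht.2]⟩
        have h1 := ih s hs (t - δ) hm (by linarith) (by linarith)
        have h2 := h (t - δ) hm t ht (by linarith) (by linarith)
        linarith [dist_triangle (y s) (y (t - δ)) (y t)]
  intro s hs t ht hst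
  obtain ⟨k, hk⟩ := exists_nat_ge ((t - s) / δ)
  exact key k s hs t ht hst (by rwa [div_le_iff₀ hδ] at hk)

lemma ae_restrict_timeInterval {p : ℝ → Prop}
    (h : ∀ a b, a < b → Icc a b ⊆ timeInterval T → ∀ᵐ t, t ∈ Ioo a b → p t) :
    ∀ᵐ t ∂(volume.restrict (timeInterval T)), p t := by
  rw [ae_restrict_iff' (isOpen_timeInterval T).measurableSet, ae_iff]
  refine measure_null_of_locally_null _ fun x hx => ?_
  obtain ⟨hxT, -⟩ := Classical.not_imp.1 hx
  obtain ⟨ε, hε, hball⟩ := Metric.isOpen_iff.1 (isOpen_timeInterval T) x hxT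
  have hsub : Icc (x - ε / 2) (x + ε / 2) ⊆ timeInterval T := fun z hz =>
    hball (by rw [Metric.mem_ball, Real.dist_eq, abs_lt]; constructor <;> linarith [hz.1, hz.2])
  have h1 := h (x - ε / 2) (x + ε / 2) (by linarith) hsub
  rw [ae_iff] at h1
  refine ⟨_, ?_, h1⟩
  filter_upwards [self_mem_nhdsWithin,
    nhdsWithin_le_nhds (Ioo_mem_nhds (show x - ε / 2 < x by linarith)
      (show x < x + ε / 2 by linarith))] with z hz hz2
  exact fun hcon => (Classical.not_imp.1 hz).2 (hcon hz2)

lemma tendsto_setLIntegral_Ioo_left (g : ℝ → ℝ≥0∞) (a t : ℝ) :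
    Tendsto (fun s => ∫⁻ r in Ioo s t, g r) (𝓝[>] a) (𝓝 (∫⁻ r in Ioo a t, g r)) := by
  have hmono : ∀ s s', s ≤ s' → ∫⁻ r in Ioo s' t, g r ≤ ∫⁻ r in Ioo s t, g r := fun s s' hs =>
    lintegral_mono_set (Ioo_subset_Ioo_left hs)
  have hU : Ioo a t = ⋃ n : ℕ, Ioo (a + 1 / ((n : ℝ) + 1)) t := by
    ext x
    simp only [mem_iUnion, mem_Ioo]
    constructor
    · rintro ⟨h1, h2⟩
      obtain ⟨n, hn⟩ := exists_nat_one_div_lt (sub_pos.2 h1)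
      exact ⟨n, by linarith, h2⟩
    · rintro ⟨n, h1, h2⟩
      have : (0 : ℝ) < 1 / ((n : ℝ) + 1) := by positivity
      exact ⟨by linarith, h2⟩
  have hdir : Directed (· ⊆ ·) fun n : ℕ => Ioo (a + 1 / ((n : ℝ) + 1)) t := by
    refine directed_of_isDirected_le fun m n hmn => Ioo_subset_Ioo_left ?_
    have := Nat.one_div_le_one_div (α := ℝ) hmn
    linarith
  rw [tendsto_order]
  constructor
  · intro c hc
    rw [hU, setLIntegral_iUnion_of_directed _ hdir] at hc
    obtain ⟨n, hn⟩ := lt_iSup_iff.1 hc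
    have hpos : a < a + 1 / ((n : ℝ) + 1) := by
      have : (0 : ℝ) < 1 / ((n : ℝ) + 1) := by positivity
      linarith
    filter_upwards [Ioo_mem_nhdsGT hpos] with s hs
    exact hn.trans_le (hmono _ _ hs.2.le)
  · intro c hc
    filter_upwards [self_mem_nhdsWithin] with s hs
    exact (hmono a s (le_of_lt hs)).trans_lt hc

/-! ### Identification of the dissipation and conclusion. -/

namespace IsEVICurve

/-- Where the energy is differentiable and the metric derivative exists, the speed, the slope and
the dissipation rate are related as for a smooth gradient flow. -/
lemma dissipation_eq (hf : LowerSemicontinuous f) (hN : N < 0) (hy : IsEVICurve f K N T y)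
    {t : ℝ} (ht : t ∈ timeInterval T) {e' m : ℝ} (he : HasDerivAt (energy f y) e' t)
    (hm : Tendsto (fun s => dist (y s) (y t) / |s - t|) (𝓝[≠] t) (𝓝 m)) :
    m ^ 2 = -e' ∧ metricDeriv y t = ENNReal.ofReal m ∧
      dissipation f y t = ENNReal.ofReal (-e') := by
  have hm0 : 0 ≤ m := ge_of_tendsto' hm fun s => by positivity
  have hshift := tendsto_add_nhdsGT_zero t
  have hmr : Tendsto (fun h => dist (y (t + h)) (y t) / h) (𝓝[>] (0 : ℝ)) (𝓝 m) := by
    refine (hm.comp hshift).congr' ?_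
    filter_upwards [self_mem_nhdsWithin] with h hh
    simp [abs_of_pos (show 0 < h from hh)]
  have her : Tendsto (fun h => (energy f y t - energy f y (t + h)) / h) (𝓝[>] (0 : ℝ))
      (𝓝 (-e')) := by
    refine ((hasDerivAt_iff_tendsto_slope.1 he).comp hshift).neg.congr fun h => ?_
    simp only [Function.comp, slope_def_field]
    rw [add_sub_cancel_left, ← neg_div, neg_sub]
  have hTev : ∀ᶠ h in 𝓝[>] (0 : ℝ), t + h ∈ timeInterval T :=
    (tendsto_nhdsWithin_iff.1 hshift).1.eventually ((isOpen_timeInterval T).mem_nhds ht)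
  have he0 : 0 ≤ -e' := by
    refine ge_of_tendsto her ?_
    filter_upwards [hTev, self_mem_nhdsWithin] with h hh h0
    have h0' : 0 < h := h0
    have := hy.energy_antitoneOn hf hN ht hh (by linarith)
    exact div_nonneg (by linarith) h0'.le
  have h1 : m ^ 2 ≤ -e' := by
    refine le_of_forall_gt_imp_ge_of_dense fun c hc => ?_
    refine le_of_tendsto (hmr.pow 2) ?_
    filter_upwards [hy.eventually_dist_sq_le hN ht he (he0.trans_lt hc) hc,
      self_mem_nhdsWithin] with h hh h0
    have h0' : 0 < h := h0
    rw [div_pow, div_le_iff₀ (by positivity)]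
    exact hh
  -- The two other links of the chain: `|D⁻f| ≤ m` here, and `-e' ≤ |D⁻f| * m` in `h3`.
  have hD : descSlope f (y t) ≤ ENNReal.ofReal m := by
    refine ENNReal.le_of_forall_pos_le_add fun ε hε _ => ?_
    have hε' : (0 : ℝ) < ε := hε
    have h2 := hy.descSlope_le hf hN ht (σ := m + ε / 2) (σ' := m + ε)
      (by linarith) (by
        refine Eventually.frequently ?_
        filter_upwards [hmr.eventually (eventually_lt_nhds (show m < m + ε / 2 by linarith)),
          self_mem_nhdsWithin] with h hh h0
        rw [div_lt_iff₀ h0] at hh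
        exact hh.le)
    rwa [ENNReal.ofReal_add hm0 hε'.le, ENNReal.ofReal_coe_nnreal] at h2
  have hDtop : descSlope f (y t) ≠ ⊤ := ne_top_of_le_ne_top ENNReal.ofReal_ne_top hD
  set D := (descSlope f (y t)).toReal with hDdef
  have hDD : descSlope f (y t) = ENNReal.ofReal D := (ENNReal.ofReal_toReal hDtop).symm
  have hD0 : 0 ≤ D := ENNReal.toReal_nonneg
  have hDm : D ≤ m := by
    rw [hDD] at hD; exact (ENNReal.ofReal_le_ofReal_iff hm0).1 hD
  have h3 : -e' ≤ D * m := by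
    have h4 : ∀ ε > 0, -e' ≤ (D + ε) * m := by
      intro ε hε
      refine le_of_tendsto_of_tendsto her (hmr.const_mul (D + ε)) ?_
      have h5 : descSlope f (y t) < ENNReal.ofReal (D + ε) := by
        rw [hDD, ENNReal.ofReal_lt_ofReal_iff_of_nonneg hD0]; linarith
      filter_upwards [hy.eventually_energy_sub_le ht h5, self_mem_nhdsWithin] with h hh h0
      have h0' : 0 < h := h0
      rw [← mul_div_assoc]
      gcongr
    refine le_of_forall_pos_le_add fun ε hε => ?_
    have h5 := h4 (ε / (m + 1)) (by positivity)
    have h6 : ε / (m + 1) * m ≤ ε := by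
      rw [div_mul_eq_mul_div, div_le_iff₀ (by positivity)]
      nlinarith
    linarith
  have h7 : D * m ≤ m ^ 2 := by nlinarith
  have h8 : m ^ 2 = -e' := le_antisymm h1 (h3.trans h7)
  have h9 : D = m := by
    rcases hm0.eq_or_lt with h | h
    · linarith
    · have : m * m ≤ D * m := by nlinarith
      exact le_antisymm hDm (le_of_mul_le_mul_right this h)
  have hmd : metricDeriv y t = ENNReal.ofReal m := (tendsto_metricQuotient hm).limsup_eq
  refine ⟨h8, hmd, ?_⟩
  rw [dissipation, hmd, hDD, h9, ENNReal.add_halves, ← ENNReal.ofReal_pow hm0, h8]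

lemma exists_metricDeriv (hf : LowerSemicontinuous f) (hN : N < 0) (hy : IsEVICurve f K N T y)
    {a b : ℝ} (hab : a < b) (hI : Icc a b ⊆ timeInterval T) :
    IntervalIntegrable (fun t => (metricDeriv y t).toReal) volume a b ∧
      (∀ s ∈ Icc a b, ∀ t ∈ Icc a b, s ≤ t →
        dist (y s) (y t) ≤ ∫ r in s..t, (metricDeriv y r).toReal) ∧
      ∀ᵐ t, t ∈ Ioo a b → HasDerivAt (energy f y) (deriv (energy f y) t) t ∧
        Tendsto (fun s => dist (y s) (y t) / |s - t|) (𝓝[≠] t)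
          (𝓝 (metricDeriv y t).toReal) := by
  have hanti := (hy.energy_antitoneOn hf hN).mono hI
  obtain ⟨C, hC, δ, hδ, hdist⟩ := hy.exists_dist_sq_le hf hN hI
  have hac := absolutelyContinuousOnInterval_of_dist_sq_le hab.le hanti hC hδ hdist
  -- The majorant comes from `d² ≤ C * Δt * ΔE ≤ (C * Δt + ΔE)²`, first on short steps and then by
  -- chaining.
  have hV := dist_le_of_forall_dist_le (y := y) (W := fun t => C * t - energy f y t) hδ
    (fun s hs t ht hst hts => by
      have h1 := hdist s hs t ht hst hts
      have h2 := hanti hs ht hst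
      have h3 : 0 ≤ C * (t - s) := mul_nonneg hC.le (by linarith)
      have h4 : dist (y s) (y t) ≤ C * (t - s) + (energy f y s - energy f y t) := by
        refine le_of_sq_le_sq ?_ (by linarith)
        nlinarith
      linarith)
  have hVmono : MonotoneOn (fun t => C * t - energy f y t) (Icc a b) := by
    intro s hs t ht hst
    have := hanti hs ht hst
    have : C * s ≤ C * t := by gcongr
    simp only
    linarith
  obtain ⟨m, hm0, hmint, hmdist, hmlim⟩ :=
    exists_metric_derivative hab (hy.continuousOn.mono hI) hac hVmono hV
  have hae : ∀ᵐ t, t ∈ Ioo a b → (metricDeriv y t).toReal = m t := by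
    filter_upwards [hmlim] with t ht htI
    rw [show metricDeriv y t = ENNReal.ofReal (m t) from
      (tendsto_metricQuotient (ht htI)).limsup_eq, ENNReal.toReal_ofReal (hm0 t)]
  have hae' : ∀ᵐ t ∂(volume.restrict (Ioc a b)), m t = (metricDeriv y t).toReal := by
    rw [← restrict_Ioo_eq_restrict_Ioc]
    refine (ae_restrict_iff' measurableSet_Ioo).2 ?_
    filter_upwards [hae] with t ht htI using (ht htI).symm
  refine ⟨hmint.congr_ae (by rwa [uIoc_of_le hab.le]), ?_, ?_⟩
  · intro s hs t ht hst
    refine (hmdist s hs t ht hst).trans_eq (intervalIntegral.integral_congr_ae_restrict ?_)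
    rw [uIoc_of_le hst]
    exact ae_mono (Measure.restrict_mono (Ioc_subset_Ioc hs.1 ht.2) le_rfl) hae'
  · filter_upwards [hmlim, hae, hanti.neg.ae_differentiableWithinAt_of_mem] with t h1 h2 h3 htI
    refine ⟨?_, by rw [h2 htI]; exact h1 htI⟩
    have h4 := ((h3 (Ioo_subset_Icc_self htI)).differentiableAt
      (Icc_mem_nhds htI.1 htI.2)).neg
    simp only [Pi.neg_def, neg_neg] at h4
    exact h4.hasDerivAt

lemma ae_dissipation_eq (hf : LowerSemicontinuous f) (hN : N < 0) (hy : IsEVICurve f K N T y)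
    {a b : ℝ} (hab : a < b) (hI : Icc a b ⊆ timeInterval T) :
    ∀ᵐ t, t ∈ Ioo a b → HasDerivAt (energy f y) (deriv (energy f y) t) t ∧
      Tendsto (metricQuotient y t) (𝓝[≠] t) (𝓝 (metricDeriv y t)) ∧
      (metricDeriv y t).toReal ^ 2 = -deriv (energy f y) t ∧
      dissipation f y t = ENNReal.ofReal (-deriv (energy f y) t) := by
  filter_upwards [(hy.exists_metricDeriv hf hN hab hI).2.2] with t ht htI
  obtain ⟨h1, h2⟩ := ht htI
  obtain ⟨h3, h4, h5⟩ := hy.dissipation_eq hf hN (hI (Ioo_subset_Icc_self htI)) h1 h2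
  refine ⟨h1, ?_, h3, h5⟩
  have h6 := tendsto_metricQuotient h2
  rwa [← h4] at h6

/-- The squared speed is almost everywhere `-E'`, and the derivative of a monotone function is
integrable. Absolute continuity of the energy is not needed, which matters because its proof relies
on this lemma. -/
lemma memLp_metricDeriv (hf : LowerSemicontinuous f) (hN : N < 0) (hy : IsEVICurve f K N T y)
    {a b : ℝ} (hab : a < b) (hI : Icc a b ⊆ timeInterval T) :
    MemLp (fun t => (metricDeriv y t).toReal) 2 (volume.restrict (Icc a b)) := by
  have hint := (hy.exists_metricDeriv hf hN hab hI).1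
  rw [intervalIntegrable_iff_integrableOn_Icc_of_le hab.le] at hint
  rw [memLp_two_iff_integrable_sq hint.aestronglyMeasurable]
  have hanti := ((hy.energy_antitoneOn hf hN).mono hI).neg
  rw [← uIcc_of_le hab.le] at hanti
  have hd := hanti.intervalIntegrable_deriv
  rw [intervalIntegrable_iff_integrableOn_Icc_of_le hab.le] at hd
  refine hd.congr ?_
  rw [← restrict_Ioo_eq_restrict_Icc]
  refine (ae_restrict_iff' measurableSet_Ioo).2 ?_
  filter_upwards [hy.ae_dissipation_eq hf hN hab hI] with t ht htI
  rw [(ht htI).2.2.1]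
  exact deriv.neg

lemma absolutelyContinuousOnInterval_energy (hf : LowerSemicontinuous f) (hN : N < 0)
    (hy : IsEVICurve f K N T y) {a b : ℝ} (hab : a < b) (hI : Icc a b ⊆ timeInterval T) :
    AbsolutelyContinuousOnInterval (energy f y) a b := by
  have ha := hI (left_mem_Icc.2 hab.le)
  have hb := hI (right_mem_Icc.2 hab.le)
  have ha0 : 0 < a := ha.1
  have ha' : a / 2 < a := by linarith
  have hI' : Icc (a / 2) b ⊆ timeInterval T := Icc_subset_timeInterval (by linarith) hb.2
  have hab' : a / 2 < b := ha'.trans hab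
  obtain ⟨C, hC, δ, hδ, hslope⟩ := hy.exists_energy_sub_le hf hN hI'
  obtain ⟨hmint, hmdist, hmlim⟩ := hy.exists_metricDeriv hf hN hab' hI'
  -- One function dominates both factors of the slope bound, `C * (|ẏ| + 2)` and the speed `|ẏ|`.
  -- The interval starts at `a / 2` to leave the margin to the left of `a`.
  have hmem : MemLp (fun t => (C + 1) * ((metricDeriv y t).toReal + 2)) 2
      (volume.restrict (Icc (a / 2) b)) :=
    ((hy.memLp_metricDeriv hf hN hab' hI').add (memLp_const 2)).const_mul (C + 1)
  have hM0 : ∀ t, 0 ≤ (C + 1) * ((metricDeriv y t).toReal + 2) := fun t => by positivity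
  have hM : IntervalIntegrable (fun t => (C + 1) * ((metricDeriv y t).toReal + 2)) volume
      (a / 2) b := (hmint.add intervalIntegrable_const).const_mul _
  refine absolutelyContinuousOnInterval_of_slope_bound
    (M := fun t => (C + 1) * ((metricDeriv y t).toReal + 2)) ha' hab.le
    ((hy.energy_antitoneOn hf hN).mono hI') hM0 hM
    ((intervalIntegrable_iff_integrableOn_Icc_of_le hab'.le).2 hmem.integrable_sq) hδ ?_
  filter_upwards [hmlim, Measure.ae_ne volume (a / 2), Measure.ae_ne volume b]
    with r hr hra hrb hrI t ht hrt hrδ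
  have hrI' : r ∈ Ioo (a / 2) b := ⟨lt_of_le_of_ne hrI.1 hra.symm, lt_of_le_of_ne hrI.2 hrb⟩
  have hlim := (hr hrI').2
  have hshift := tendsto_add_nhdsGT_zero r
  have hfreq : ∃ᶠ h in 𝓝[>] (0 : ℝ),
      dist (y (r + h)) (y r) ≤ ((metricDeriv y r).toReal + 1) * h := by
    refine Eventually.frequently ?_
    filter_upwards [(hlim.comp hshift).eventually
      (eventually_lt_nhds (lt_add_one (metricDeriv y r).toReal)), self_mem_nhdsWithin]
      with h hh h0
    have h0' : 0 < h := h0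
    simp only [Function.comp, add_sub_cancel_left, abs_of_pos h0'] at hh
    rw [div_lt_iff₀ h0'] at hh
    exact hh.le
  have h1 := hslope r hrI _ (by positivity) hfreq t ht hrt hrδ
  have h2 := hmdist r hrI t ht hrt
  have hsub : uIcc r t ⊆ uIcc (a / 2) b := by
    rw [uIcc_of_le hab'.le]; exact uIcc_subset_Icc hrI ht
  have h3 : ∫ x in r..t, (metricDeriv y x).toReal ≤
      ∫ x in r..t, (C + 1) * ((metricDeriv y x).toReal + 2) := by
    refine intervalIntegral.integral_mono_on hrt (hmint.mono_set hsub) (hM.mono_set hsub)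
      fun x _ => ?_
    have : 0 ≤ (metricDeriv y x).toReal := ENNReal.toReal_nonneg
    nlinarith
  have hm0 : 0 ≤ (metricDeriv y r).toReal := ENNReal.toReal_nonneg
  calc energy f y r - energy f y t
      ≤ C * ((metricDeriv y r).toReal + 1 + 1) * dist (y r) (y t) := h1
    _ ≤ (C + 1) * ((metricDeriv y r).toReal + 2) *
        ∫ x in r..t, (C + 1) * ((metricDeriv y x).toReal + 2) := by
      refine mul_le_mul ?_ (h2.trans h3) dist_nonneg (hM0 r)
      nlinarith

lemma ae_dissipation_eq_restrict (hf : LowerSemicontinuous f) (hN : N < 0)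
    (hy : IsEVICurve f K N T y) :
    ∀ᵐ t ∂(volume.restrict (timeInterval T)),
      HasDerivAt (energy f y) (deriv (energy f y) t) t ∧
      Tendsto (metricQuotient y t) (𝓝[≠] t) (𝓝 (metricDeriv y t)) ∧
      (metricDeriv y t).toReal ^ 2 = -deriv (energy f y) t ∧
      dissipation f y t = ENNReal.ofReal (-deriv (energy f y) t) :=
  ae_restrict_timeInterval fun _ _ hab hI => hy.ae_dissipation_eq hf hN hab hI

lemma aemeasurable_dissipation (hf : LowerSemicontinuous f) (hN : N < 0)
    (hy : IsEVICurve f K N T y) :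
    AEMeasurable (dissipation f y) (volume.restrict (timeInterval T)) :=
  ⟨fun t => ENNReal.ofReal (-deriv (energy f y) t), (measurable_deriv _).neg.ennreal_ofReal, by
    filter_upwards [hy.ae_dissipation_eq_restrict hf hN] with t ht using ht.2.2.2⟩

lemma acLoc_two (hf : LowerSemicontinuous f) (hN : N < 0) (hy : IsEVICurve f K N T y) :
    ACLoc 2 (timeInterval T) y := by
  refine ⟨fun t => (metricDeriv y t).toReal, fun a b hI => ?_, fun s hs t ht hst => ?_⟩
  · rcases lt_or_ge a b with hab | hab
    · exact hy.memLp_metricDeriv hf hN hab hI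
    · have : volume.restrict (Icc a b) = 0 := by
        rw [Measure.restrict_eq_zero, Real.volume_Icc]
        simpa using hab
      rw [this]
      exact memLp_measure_zero
  · rcases hst.eq_or_lt with rfl | hlt
    · simp
    · exact (hy.exists_metricDeriv hf hN hlt (Icc_subset_timeInterval_of_mem hs ht)).2.1 s
        (left_mem_Icc.2 hst) t (right_mem_Icc.2 hst) hst

lemma acLoc_energy (hf : LowerSemicontinuous f) (hN : N < 0) (hy : IsEVICurve f K N T y) :
    ACLoc 1 (timeInterval T) (energy f y) := by
  refine ⟨fun t => |deriv (energy f y) t|, fun a b hI => ?_, fun s hs t ht hst => ?_⟩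
  · rcases lt_or_ge a b with hab | hab
    · have := (hy.absolutelyContinuousOnInterval_energy hf hN hab hI).intervalIntegrable_deriv.abs
      rw [intervalIntegrable_iff_integrableOn_Icc_of_le hab.le] at this
      exact memLp_one_iff_integrable.2 this
    · have : volume.restrict (Icc a b) = 0 := by
        rw [Measure.restrict_eq_zero, Real.volume_Icc]
        simpa using hab
      rw [this]
      exact memLp_measure_zero
  · rcases hst.eq_or_lt with rfl | hlt
    · simp
    · have := (hy.absolutelyContinuousOnInterval_energy hf hN hlt
        (Icc_subset_timeInterval_of_mem hs ht)).integral_deriv_eq_sub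
      rw [dist_comm, Real.dist_eq, ← this]
      exact intervalIntegral.abs_integral_le_integral_abs hst

lemma isMaxSlopeCurve (hf : LowerSemicontinuous f) (hN : N < 0) (hy : IsEVICurve f K N T y) :
    IsMaxSlopeCurve f T y where
  mem_domain := hy.mem_domain
  acLoc := by
    obtain ⟨m, hm, hd⟩ := hy.acLoc_two hf hN
    exact ⟨m, fun a b hI => (hm a b hI).mono_exponent one_le_two, hd⟩
  acLoc_energy := hy.acLoc_energy hf hN
  slope_le := by
    filter_upwards [hy.ae_dissipation_eq_restrict hf hN] with t ht
    refine ⟨ht.2.1, deriv (energy f y) t, ht.1, ?_⟩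
    rw [ht.2.2.2, EReal.coe_ennreal_ofReal,
      max_eq_left (by rw [← ht.2.2.1]; exact sq_nonneg _)]

lemma setLIntegral_dissipation (hf : LowerSemicontinuous f) (hN : N < 0)
    (hy : IsEVICurve f K N T y) {s t : ℝ} (hs : s ∈ timeInterval T) (ht : t ∈ timeInterval T)
    (hst : s < t) :
    ∫⁻ r in Ioo s t, dissipation f y r = ENNReal.ofReal (energy f y s - energy f y t) := by
  have hI := Icc_subset_timeInterval_of_mem hs ht
  have hac := hy.absolutelyContinuousOnInterval_energy hf hN hst hI
  have hae := (ae_restrict_iff' measurableSet_Ioo).2 (hy.ae_dissipation_eq hf hN hst hI)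
  have hint := hac.intervalIntegrable_deriv.neg
  rw [intervalIntegrable_iff_integrableOn_Ioc_of_le hst.le, IntegrableOn,
    ← restrict_Ioo_eq_restrict_Ioc] at hint
  have h1 : ∫⁻ r in Ioo s t, dissipation f y r =
      ∫⁻ r in Ioo s t, ENNReal.ofReal (-deriv (energy f y) r) :=
    lintegral_congr_ae (by filter_upwards [hae] with r hr using hr.2.2.2)
  have h2 := ofReal_integral_eq_lintegral_ofReal hint (by
    filter_upwards [hae] with r hr
    simp only [Pi.neg_apply, Pi.zero_apply]
    rw [← hr.2.2.1]
    exact sq_nonneg _)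
  rw [h1]
  refine h2.symm.trans ?_
  rw [restrict_Ioo_eq_restrict_Ioc, ← intervalIntegral.integral_of_le hst.le]
  simp only [Pi.neg_apply]
  rw [intervalIntegral.integral_neg, hac.integral_deriv_eq_sub, neg_sub]

/-- The identity on `(s, t)` passes to the limit `s ↓ 0` by monotone convergence; addition is
continuous there because `f (y t)` is finite. Uniqueness of limits then makes the expression
independent of `t`. -/
lemma tendsto_energy (hf : LowerSemicontinuous f) (hN : N < 0) (hy : IsEVICurve f K N T y)
    {t : ℝ} (ht : t ∈ timeInterval T) :
    Tendsto (fun ε => f (y ε)) (𝓝[>] (0 : ℝ))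
      (𝓝 (f (y t) + ((∫⁻ s in Ioo 0 t, dissipation f y s : ℝ≥0∞) : EReal))) := by
  have h1 := (continuous_coe_ennreal_ereal.tendsto _).comp
    (tendsto_setLIntegral_Ioo_left (dissipation f y) 0 t)
  have h2 := (EReal.continuousAt_add
    (p := (f (y t), ((∫⁻ s in Ioo 0 t, dissipation f y s : ℝ≥0∞) : EReal)))
    (Or.inl (hy.mem_domain t ht).2) (Or.inl (hy.mem_domain t ht).1)).tendsto.comp
      (tendsto_const_nhds.prodMk_nhds h1)
  refine h2.congr' ?_
  filter_upwards [Ioo_mem_nhdsGT ht.1] with s hs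
  have hsT : s ∈ timeInterval T :=
    ⟨hs.1, (EReal.coe_lt_coe_iff.2 hs.2).trans ht.2⟩
  simp only [Function.comp]
  rw [hy.setLIntegral_dissipation hf hN hsT ht hs.2, EReal.coe_ennreal_ofReal,
    max_eq_left (sub_nonneg.2 (hy.energy_antitoneOn hf hN hsT ht hs.2.le)),
    hy.coe_energy ht, hy.coe_energy hsT, ← EReal.coe_add, add_sub_cancel]

lemma exists_mem_timeInterval (hT : 0 < T) : ∃ t, t ∈ timeInterval T := by
  obtain ⟨t, h0, ht⟩ := EReal.lt_iff_exists_real_btwn.1 hT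
  exact ⟨t, by exact_mod_cast h0, ht⟩

lemma satisfiesEDE (hf : LowerSemicontinuous f) (hN : N < 0) (hy : IsEVICurve f K N T y) :
    SatisfiesEDE f T y := by
  obtain ⟨t₀, ht₀⟩ := exists_mem_timeInterval hy.pos
  exact ⟨hy.aemeasurable_dissipation hf hN, _, hy.tendsto_energy hf hN ht₀, fun t ht =>
    tendsto_nhds_unique (hy.tendsto_energy hf hN ht) (hy.tendsto_energy hf hN ht₀)⟩

lemma satisfiesEDI (hf : LowerSemicontinuous f) (hN : N < 0) (hy : IsEVICurve f K N T y) :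
    SatisfiesEDI f T y := by
  obtain ⟨hm, L, hL, hE⟩ := hy.satisfiesEDE hf hN
  exact ⟨hy.mem_domain, hy.acLoc_two hf hN, hm, L, hL, fun t ht => (hE t ht).le⟩

end IsEVICurve

end EVINegDim

end

theorem propositionp {X : Type*} [MetricSpace X] (f : X → EReal) (hf : LowerSemicontinuous f)
    (K N : ℝ) (hN : N < 0) (T : EReal) (y : ℝ → X) (hy : EVINegDim.IsEVICurve f K N T y) :
    EVINegDim.IsMaxSlopeCurve f T y ∧ EVINegDim.SatisfiesEDE f T y ∧
      EVINegDim.SatisfiesEDI f T y :=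
  ⟨hy.isMaxSlopeCurve hf hN, hy.satisfiesEDE hf hN, hy.satisfiesEDI hf hN⟩
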